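/- Let $\mathcal{L}$ be a complex simple Lie algebra of simply laced type and rank at least $3$ (that is, of type $A_n$ with $n\ge 3$, $D_n$ with $n\ge 4$, or $E_6,E_7,E_8$), let $\mathcal{H}$ be a Cartan subalgebra, $\Phi\subseteq\mathcal{H}^*$ the set of roots, $\Delta$ a base of $\Phi$, and $\omega$ the highest root with respect to $\Delta$. For $\alpha\in\Phi$ let $h_\alpha\in\mathcal{H}$ be its coroot. Let $\{h_\alpha\mid\alpha\in\Delta\}\cup\{e_\alpha\mid\alpha\in\Phi\}$ be a Chevalley basis of $\mathcal{L}$: each $e_\alpha$ lies in the root space of $\alpha$, $[e_\alpha,e_{-\alpha}]=h_\alpha$, and $[e_\alpha,e_\beta]=c_{\alpha,\beta}e_{\alpha+\beta}$ with $c_{\alpha,\beta}=-c_{-\alpha,-\beta}$ whenever $\alpha,\beta,\alpha+\beta\in\Phi$. Let $\kappa$ be the multiple of the Killing form of $\mathcal{L}$ with $\kappa(h_\alpha,h_\alpha)=2$ for all $\alpha\in\Phi$, and put $\kappa(\alpha,\beta)=\kappa(h_\alpha,h_\beta)$ for $\alpha,\beta\in\Phi$. Let $S^2(\mathcal{L})$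 be the symmetric square of the adjoint representation, let $\ell_1\ell_2$ denote the image of $\ell_1\otimes\ell_2$ in it, and let $\mathcal{V}$ be the subrepresentation of $S^2(\mathcal{L})$ generated by $e_\omega e_\omega$. Put \begin{align*} \Gamma_0 &= \{2e_\alpha e_{-\alpha}-h_\alpha h_\alpha \mid \alpha\in\Phi\},\\ \Gamma_1 &= \{e_\alpha h_\alpha \mid \alpha\in\Phi\},\\ \Gamma_2 &= \{2e_\alpha e_\beta + c_{\alpha,\beta}\,e_{\alpha+\beta}(h_\beta-h_\alpha) \mid \alpha,\beta\in\Phi,\ \kappa(\alpha,\beta)=-1\},\\ \Gamma_3 &= \Bigl\{e_\alpha e_\beta + \frac{c_{\alpha,-\gamma}}{c_{\beta,-\delta}}\,e_\gamma e_\delta \Bigm| \alpha,\beta,\gamma,\delta\in\Phi,\ \kappa(\alpha,\beta)=0,\ \gamma+\delta=\alpha+\beta,\ \{\gamma,\delta\}\ne\{\alpha,\beta\}\Bigr\},\\ \Gamma_4 &= \{e_\alpha e_\beta \mid \alpha,\beta\in\Phi,\ \kappa(\alpha,\beta)=1\},\\ \Gamma_5 &= \{e_\alpha e_\alpha \mid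 \alpha\in\Phi\}. \end{align*} Then $\Gamma_0\cup\Gamma_1\cup\Gamma_2\cup\Gamma_3\cup\Gamma_4\cup\Gamma_5$ spans $\mathcal{V}$ as a vector space. -/

import Mathlib

open TensorProduct

noncomputable section

namespace SymSquare

section Square

variable (R L : Type*) [CommRing R] [LieRing L] [LieAlgebra R L]

/-- The subrepresentation `⟨x ⊗ y - y ⊗ x⟩` of `L ⊗ L`. -/
def antiRel : LieSubmodule R L (L ⊗[R] L) where
  toSubmodule := Submodule.span R {t | ∃ x y : L, t = x ⊗ₜ[R] y - y ⊗ₜ[R] x}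
  lie_mem := by
    intro l m hm
    change ⁅l, m⁆ ∈ Submodule.span R {t | ∃ x y : L, t = x ⊗ₜ[R] y - y ⊗ₜ[R] x}
    change m ∈ Submodule.span R {t | ∃ x y : L, t = x ⊗ₜ[R] y - y ⊗ₜ[R] x} at hm
    induction hm using Submodule.span_induction with
    | mem t ht =>
      obtain ⟨x, y, rfl⟩ := ht
      have h : ⁅l, x ⊗ₜ[R] y - y ⊗ₜ[R] x⁆ =
          (⁅l, x⁆ ⊗ₜ[R] y - y ⊗ₜ[R] ⁅l, x⁆) + (x ⊗ₜ[R] ⁅l, y⁆ - ⁅l, y⁆ ⊗ₜ[R] x) := by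
        rw [lie_sub, TensorProduct.LieModule.lie_tmul_right,
          TensorProduct.LieModule.lie_tmul_right]
        abel
      rw [h]
      exact add_mem (Submodule.subset_span ⟨_, _, rfl⟩) (Submodule.subset_span ⟨_, _, rfl⟩)
    | zero => simp
    | add u v _ _ hu hv => rw [lie_add]; exact add_mem hu hv
    | smul c u _ hu => rw [lie_smul]; exact Submodule.smul_mem _ c hu

/-- The symmetric square `S²(L)` of the adjoint representation, as a representation of `L`. -/
abbrev S2 : Type _ := (L ⊗[R] L) ⧸ antiRel R L

variable {L}

/-- The image `x y` of `x ⊗ y` in `S²(L)`. -/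
def prod (x y : L) : S2 R L := LieSubmodule.Quotient.mk' (antiRel R L) (x ⊗ₜ[R] y)

variable {R}

/-- The action on `S²(L)` is given by the Leibniz rule. -/
theorem lie_prod (l x y : L) : ⁅l, prod R x y⁆ = prod R ⁅l, x⁆ y + prod R x ⁅l, y⁆ := by
  simp only [prod]
  rw [← LieModuleHom.map_lie, TensorProduct.LieModule.lie_tmul_right, map_add]

theorem prod_comm (x y : L) : prod R x y = prod R y x := by
  rw [← sub_eq_zero]
  simp only [prod]
  rw [← map_sub, LieSubmodule.Quotient.mk_eq_zero]
  exact Submodule.subset_span ⟨x, y, rfl⟩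

end Square

open LieAlgebra LieAlgebra.IsKilling LieModule

variable {L : Type*} [LieRing L] [LieAlgebra ℂ L] [FiniteDimensional ℂ L] [IsKilling ℂ L]
  (H : LieSubalgebra ℂ L) [H.IsCartanSubalgebra]

variable {H}

/-- The negative of a root. -/
def negRoot (α : H.root) : H.root := ⟨-α.1, by
  have h : α.1.IsNonZero := by simpa using (Finset.mem_filter.mp α.2).2
  simpa using h⟩

/-- The coroot `h_α`, as an element of `L`. -/
def hc (α : H.root) : L := (coroot α.1 : H)

/-- `ω` is the highest root with respect to the base `b`: for every root `α`, the difference `ω - α`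
is a sum of simple roots. -/
def IsHighestRoot (b : (rootSystem H).Base) (ω : H.root) : Prop :=
  ∀ α : H.root, (rootSystem H).root ω - (rootSystem H).root α ∈
    AddSubmonoid.closure ((rootSystem H).root '' b.support)

/-- The Killing form rescaled so that the coroot of `ω` satisfies `κ(h_ω, h_ω) = 2`, that is
`κ(x, y) = 2 t⁻¹ tr(ad x ad y)` with `t = tr(ad h_ω ad h_ω)`. In the simply laced irreducible case
`t` is the same for all roots. -/
def kappaForm (ω : H.root) : LinearMap.BilinForm ℂ L :=
  (2 * (killingForm ℂ L (hc ω) (hc ω))⁻¹) • killingForm ℂ L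

/-- `κ(α, β)` for roots `α`, `β`, where `α` is identified with `h_α`. -/
def kappa (ω α β : H.root) : ℂ := kappaForm ω (hc α) (hc β)

variable (H) in
/-- The root vectors `e α` of a Chevalley basis `{h_α | α ∈ Δ} ∪ {e_α | α ∈ Φ}` of `L` relative
to `H`, with its structure constants `c α β`. The value of `c α β` is meaningful only if `α + β`
is a root. -/
structure ChevalleyBasis where
  e : H.root → L
  c : H.root → H.root → ℂ
  e_mem (α : H.root) : e α ∈ rootSpace H α.1
  lie_e_neg (α : H.root) : ⁅e α, e (negRoot α)⁆ = hc α
  lie_e_e (α β γ : H.root)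
    (h : (rootSystem H).root γ = (rootSystem H).root α + (rootSystem H).root β) :
    ⁅e α, e β⁆ = c α β • e γ
  c_neg (α β γ : H.root)
    (h : (rootSystem H).root γ = (rootSystem H).root α + (rootSystem H).root β) :
    c α β = -c (negRoot α) (negRoot β)

variable (B : ChevalleyBasis H) (ω : H.root)

/-- The subrepresentation `𝒱` of `S²(L)` generated by `e_ω e_ω`. -/
def V : LieSubmodule ℂ L (S2 ℂ L) := LieSubmodule.lieSpan ℂ L {prod ℂ (B.e ω) (B.e ω)}

def Gamma0 : Set (S2 ℂ L) :=
  {v | ∃ α : H.root,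
    v = (2 : ℂ) • prod ℂ (B.e α) (B.e (negRoot α)) - prod ℂ (hc α) (hc α)}

def Gamma1 : Set (S2 ℂ L) :=
  {v | ∃ α : H.root, v = prod ℂ (B.e α) (hc α)}

/-- Here `γ` is the root `α + β`. -/
def Gamma2 : Set (S2 ℂ L) :=
  {v | ∃ α β γ : H.root, kappa ω α β = -1 ∧
    (rootSystem H).root γ = (rootSystem H).root α + (rootSystem H).root β ∧
    v = (2 : ℂ) • prod ℂ (B.e α) (B.e β) + B.c α β • prod ℂ (B.e γ) (hc β - hc α)}

def Gamma3 : Set (S2 ℂ L) :=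
  {v | ∃ α β γ δ : H.root, kappa ω α β = 0 ∧
    (rootSystem H).root γ + (rootSystem H).root δ =
      (rootSystem H).root α + (rootSystem H).root β ∧
    ({γ, δ} : Set H.root) ≠ {α, β} ∧
    v = prod ℂ (B.e α) (B.e β) +
      (B.c α (negRoot γ) / B.c β (negRoot δ)) • prod ℂ (B.e γ) (B.e δ)}

def Gamma4 : Set (S2 ℂ L) :=
  {v | ∃ α β : H.root, kappa ω α β = 1 ∧ v = prod ℂ (B.e α) (B.e β)}

def Gamma5 : Set (S2 ℂ L) :=
  {v | ∃ α : H.root, v = prod ℂ (B.e α) (B.e α)}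

end SymSquare

end

/-! Work dually. A linear map `f` on the symmetric square is a symmetric bilinear map `q` on `L`,
and `f` kills all the sets `Γ` exactly when `q` satisfies `CartanRelations`
(`cartanRelations_of_Gamma`, `map_Gamma_eq_zero`). In these relations `Γ₂` is simplified by means of
`Γ₁`, and `Γ₃` becomes a relation on a square of roots `x, y, w + x, w + y`, cleared of
denominators.

For `Γ ⊆ V`, let `f` be the quotient map by `V`. It is equivariant and kills `e_ω e_ω`. Root vectors
carry `q(e_x, e_x) = 0` from a root to every root not orthogonal to it, hence to all roots by
irreducibility (`cartanRelations_of_isConnected`). Each relation is then a first or second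
derivative of some `q(e_x, e_x) = 0`.

For `V ⊆ span Γ`, let `f` be the quotient map by `W = span Γ`. The derivative along any root vector
of each relation is again a consequence of the relations (the lemmas `deriv_...`). So every root
vector preserves `W`; root vectors generate `L`, so `W` is a subrepresentation, and it contains `e_ω
e_ω`.

The derivative computations are case checks on inner products in `{-2, …, 2}`. They use only that
structure constants are signs with cyclic symmetry and satisfy one Jacobi identity. They are carried
out over an abstract lattice, where sums of roots can be written freely and inner products are
integers. -/

/-! ### Abstract simply laced data and identities for its structure constants. -/

/-- The root vectors and coroots of a simply laced semisimple complex Lie algebra, indexed by the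
elements of an abstract root lattice `M`. -/
structure SimplyLacedData (M L : Type*) [AddCommGroup M] [LieRing L] [LieAlgebra ℂ L] where
  Φ : Set M
  p : M → M → ℤ
  h : M → L
  e : M → L
  N : M → M → ℂ
  p_add_left (x y z : M) : p (x + y) z = p x z + p y z
  p_comm (x y : M) : p x y = p y x
  p_self (x : M) (hx : x ∈ Φ) : p x x = 2
  neg_le_p (x y : M) (hx : x ∈ Φ) (hy : y ∈ Φ) : -2 ≤ p x y
  eq_of_p_eq_two (x y : M) (hx : x ∈ Φ) (hy : y ∈ Φ) (hxy : p x y = 2) : x = y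
  neg_mem (x : M) (hx : x ∈ Φ) : -x ∈ Φ
  add_mem (x y : M) (hx : x ∈ Φ) (hy : y ∈ Φ) (hxy : p x y = -1) : x + y ∈ Φ
  h_add (x y : M) : h (x + y) = h x + h y
  e_ne_zero (x : M) (hx : x ∈ Φ) : e x ≠ 0
  lie_h_e (x y : M) (hy : y ∈ Φ) : ⁅h x, e y⁆ = (p x y : ℂ) • e y
  lie_e_neg (x : M) (hx : x ∈ Φ) : ⁅e x, e (-x)⁆ = h x
  lie_e_e' (x y : M) (hx : x ∈ Φ) (hy : y ∈ Φ) (hxy : p x y = -1) : ⁅e x, e y⁆ = N x y • e (x + y)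
  lie_e_e_of_nonneg (x y : M) (hx : x ∈ Φ) (hy : y ∈ Φ) (hxy : 0 ≤ p x y) : ⁅e x, e y⁆ = 0
  N_neg (x y : M) (hx : x ∈ Φ) (hy : y ∈ Φ) (hxy : p x y = -1) : N x y = -N (-x) (-y)

namespace SimplyLacedData

variable {M L : Type*} [AddCommGroup M] [LieRing L] [LieAlgebra ℂ L] (D : SimplyLacedData M L)

attribute [grind =] p_add_left p_self
attribute [grind =] p_comm

@[grind =] theorem p_add_right (x y z : M) : D.p x (y + z) = D.p x y + D.p x z := by grind

theorem p_zero_left (y : M) : D.p 0 y = 0 := by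
  have := D.p_add_left 0 0 y
  simpa using this

@[grind =] theorem p_neg_left (x y : M) : D.p (-x) y = -D.p x y := by
  have := D.p_add_left x (-x) y
  rw [add_neg_cancel, p_zero_left] at this
  omega

@[grind =] theorem p_neg_right (x y : M) : D.p x (-y) = -D.p x y := by grind

@[grind =] theorem p_sub_left (x y z : M) : D.p (x - y) z = D.p x z - D.p y z := by
  grind [sub_eq_add_neg]

theorem h_zero : D.h 0 = 0 := by simpa using D.h_add 0 0

theorem h_neg (x : M) : D.h (-x) = -D.h x := by
  have := D.h_add x (-x)
  rw [add_neg_cancel, h_zero] at this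
  exact (neg_eq_of_add_eq_zero_right this.symm).symm

theorem h_sub (x y : M) : D.h (x - y) = D.h x - D.h y := by
  rw [sub_eq_add_neg, h_add, h_neg, sub_eq_add_neg]

theorem p_le (x y : M) (hx : x ∈ D.Φ) (hy : y ∈ D.Φ) : D.p x y ≤ 2 := by
  have := D.neg_le_p (-x) y (D.neg_mem x hx) hy
  grind

theorem eq_neg_of_p_eq_neg_two {x y : M} (hx : x ∈ D.Φ) (hy : y ∈ D.Φ) (hxy : D.p x y = -2) :
    x = -y :=
  D.eq_of_p_eq_two x (-y) hx (D.neg_mem y hy) (by grind)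

theorem p_cases {x y : M} (hx : x ∈ D.Φ) (hy : y ∈ D.Φ) :
    x = y ∨ D.p x y = 1 ∨ D.p x y = 0 ∨ D.p x y = -1 ∨ x = -y := by
  have h1 := D.neg_le_p x y hx hy
  have h2 := D.p_le x y hx hy
  have h3 := D.eq_of_p_eq_two x y hx hy
  have h4 := D.eq_neg_of_p_eq_neg_two hx hy
  grind

theorem lie_e_e {x y z : M} (hx : x ∈ D.Φ) (hy : y ∈ D.Φ) (hxy : D.p x y = -1)
    (hz : z = x + y) : ⁅D.e x, D.e y⁆ = D.N x y • D.e z :=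
  hz ▸ D.lie_e_e' x y hx hy hxy

theorem lie_e_neg_left {x : M} (hx : x ∈ D.Φ) : ⁅D.e (-x), D.e x⁆ = -D.h x := by
  rw [← lie_skew, D.lie_e_neg x hx]

theorem lie_e_h (x y : M) (hy : y ∈ D.Φ) : ⁅D.e y, D.h x⁆ = -(D.p x y : ℂ) • D.e y := by
  rw [← lie_skew, D.lie_h_e x y hy, neg_smul]

theorem N_comm {x y : M} (hx : x ∈ D.Φ) (hy : y ∈ D.Φ) (hxy : D.p x y = -1) :
    D.N x y = -D.N y x := by
  have h1 := D.lie_e_e hx hy hxy rfl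
  rw [← lie_skew, D.lie_e_e (z := x + y) hy hx (by grind) (by abel), ← neg_smul] at h1
  exact (smul_left_injective ℂ (D.e_ne_zero _ (D.add_mem x y hx hy hxy)) h1).symm

/-- The Jacobi identity for `e_x, e_y, e_z` with `x + y + z = 0` is a linear relation among `h_x,
h_y, h_z`. Its only source is `h_x + h_y + h_z = 0`, so its coefficients agree; this is read off
from its action on `e_x` and `e_y`. -/
theorem N_cyc {x y z : M} (hx : x ∈ D.Φ) (hy : y ∈ D.Φ) (hxy : D.p x y = -1)
    (hz : z = -(x + y)) : D.N x y = D.N y z := by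
  have hz' : z ∈ D.Φ := hz ▸ D.neg_mem _ (D.add_mem x y hx hy hxy)
  have h1 : ⁅⁅D.e x, D.e y⁆, D.e z⁆ = D.N x y • D.h (-z) := by
    rw [D.lie_e_e (z := -z) hx hy hxy (by rw [hz, neg_neg]), smul_lie]
    have := D.lie_e_neg (-z) (D.neg_mem z hz')
    rw [neg_neg] at this
    rw [this]
  have h2 : ⁅⁅D.e y, D.e z⁆, D.e x⁆ = D.N y z • D.h (-x) := by
    rw [D.lie_e_e (z := -x) hy hz' (by grind) (by rw [hz]; abel), smul_lie]
    have := D.lie_e_neg (-x) (D.neg_mem x hx)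
    rw [neg_neg] at this
    rw [this]
  have h3 : ⁅⁅D.e z, D.e x⁆, D.e y⁆ = D.N z x • D.h (-y) := by
    rw [D.lie_e_e (z := -y) hz' hx (by grind) (by rw [hz]; abel), smul_lie]
    have := D.lie_e_neg (-y) (D.neg_mem y hy)
    rw [neg_neg] at this
    rw [this]
  have hJ : D.N x y • D.h (-z) + D.N y z • D.h (-x) + D.N z x • D.h (-y) = 0 := by
    rw [← h1, ← h2, ← h3]
    have := lie_jacobi (D.e x) (D.e y) (D.e z)
    rw [← lie_skew (D.e x), ← lie_skew (D.e y) ⁅_, _⁆, ← lie_skew (D.e z) ⁅_, _⁆] at this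
    rw [← neg_eq_zero, ← this]
    abel
  have key (w : M) (hw : w ∈ D.Φ) :
      D.N x y * (D.p (-z) w : ℂ) + D.N y z * (D.p (-x) w : ℂ) + D.N z x * (D.p (-y) w : ℂ) = 0 := by
    have h4 := congrArg (fun l => ⁅l, D.e w⁆) hJ
    simp only [add_lie, smul_lie, D.lie_h_e _ w hw, zero_lie, smul_smul, ← add_smul] at h4
    exact (smul_eq_zero.mp h4).resolve_right (D.e_ne_zero w hw)
  have e1 : D.p (-z) x = 1 := by grind
  have e2 : D.p (-x) x = -2 := by grind
  have e3 : D.p (-y) x = 1 := by grind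
  have f1 : D.p (-z) y = 1 := by grind
  have f2 : D.p (-x) y = 1 := by grind
  have f3 : D.p (-y) y = -2 := by grind
  have k1 := key x hx
  have k2 := key y hy
  rw [e1, e2, e3] at k1
  rw [f1, f2, f3] at k2
  push_cast at k1 k2
  linear_combination (2 / 3 : ℂ) * k1 + (1 / 3 : ℂ) * k2

/-- Two cyclic rotations reduce this to the Chevalley normalisation `N_neg`. -/
theorem N_neg_add {x y z : M} (hx : x ∈ D.Φ) (hy : y ∈ D.Φ) (hxy : D.p x y = -1)
    (hz : z = x + y) : D.N (-x) z = D.N x y := by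
  subst hz
  have hxy' := D.add_mem x y hx hy hxy
  rw [D.N_cyc (z := -y) (D.neg_mem x hx) hxy' (by grind) (by abel),
    D.N_cyc (z := -x) hxy' (D.neg_mem y hy) (by grind) (by abel),
    D.N_comm (D.neg_mem y hy) (D.neg_mem x hx) (by grind), ← D.N_neg x y hx hy hxy]

/-- Evaluate `⁅e_{-x}, ⁅e_x, e_y⁆⁆` in two ways: with the structure constants, and by the Leibniz
rule, where only `-⁅h_x, e_y⁆ = e_y` survives. -/
theorem N_mul_self {x y : M} (hx : x ∈ D.Φ) (hy : y ∈ D.Φ) (hxy : D.p x y = -1) :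
    D.N x y * D.N x y = 1 := by
  have hxy' := D.add_mem x y hx hy hxy
  have h1 : ⁅D.e (-x), ⁅D.e x, D.e y⁆⁆ = (D.N x y * D.N x y) • D.e y := by
    rw [D.lie_e_e hx hy hxy rfl, lie_smul,
      D.lie_e_e (z := y) (D.neg_mem x hx) hxy' (by grind) (by abel), smul_smul,
      D.N_neg_add hx hy hxy rfl]
  rw [leibniz_lie, D.lie_e_neg_left hx,
    D.lie_e_e_of_nonneg (-x) y (D.neg_mem x hx) hy (by grind), lie_zero, neg_lie,
    D.lie_h_e x y hy, hxy, add_zero] at h1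
  have h2 : (1 : ℂ) • D.e y = (D.N x y * D.N x y) • D.e y := by
    rw [← h1]; push_cast; rw [neg_smul, neg_neg]
  exact (smul_left_injective ℂ (D.e_ne_zero y hy) h2).symm

theorem N_ne_zero {x y : M} (hx : x ∈ D.Φ) (hy : y ∈ D.Φ) (hxy : D.p x y = -1) :
    D.N x y ≠ 0 := fun h => by simpa [h] using D.N_mul_self hx hy hxy

/-- Since `e_x` and `e_y` commute, the two ways of reaching `x + y + z` from `z` agree. -/
theorem N_jacobi {x y z u v : M} (hx : x ∈ D.Φ) (hy : y ∈ D.Φ) (hz : z ∈ D.Φ) (hxy : D.p x y = 0)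
    (hxz : D.p x z = -1) (hyz : D.p y z = -1) (hu : u = x + z) (hv : v = y + z) :
    D.N x z * D.N y u = D.N y z * D.N x v := by
  have hu' : u ∈ D.Φ := hu ▸ D.add_mem x z hx hz hxz
  have hv' : v ∈ D.Φ := hv ▸ D.add_mem y z hy hz hyz
  have h1 := leibniz_lie (D.e x) (D.e y) (D.e z)
  have hyu : D.p y u = -1 := by grind
  rw [D.lie_e_e_of_nonneg x y hx hy hxy.ge, zero_lie, zero_add, D.lie_e_e hy hz hyz hv,
    D.lie_e_e hx hz hxz hu, lie_smul, lie_smul, D.lie_e_e hx hv' (by grind) rfl,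
    D.lie_e_e (z := x + v) hy hu' hyu (by rw [hu, hv]; abel), smul_smul, smul_smul] at h1
  exact (smul_left_injective ℂ (D.e_ne_zero _ (D.add_mem x v hx hv' (by grind))) h1).symm

theorem N_jacobi' {x y z u v : M} (hx : x ∈ D.Φ) (hy : y ∈ D.Φ) (hz : z ∈ D.Φ) (hxy : D.p x y = 0)
    (hxz : D.p x z = -1) (hyz : D.p y z = -1) (hu : u = x + z) (hv : v = z + y) :
    D.N x z * D.N u y = D.N z y * D.N x v := by
  have hu' : u ∈ D.Φ := hu ▸ D.add_mem x z hx hz hxz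
  rw [D.N_comm hu' hy (by grind), D.N_comm hz hy (by grind)]
  linear_combination -D.N_jacobi hx hy hz hxy hxz hyz hu (hv.trans (add_comm z y))

end SimplyLacedData

/-! ### The Cartan relations and the derivatives of the simpler ones. -/

namespace SimplyLacedData

variable {M L : Type*} [AddCommGroup M] [LieRing L] [LieAlgebra ℂ L] (D : SimplyLacedData M L)
variable {Q : Type*} [AddCommGroup Q] [Module ℂ Q]

/-- The relations, among the values of a symmetric bilinear map on `L`, which define the quotient
of the symmetric square by the Cartan square of the adjoint representation. -/
structure CartanRelations (q : L →ₗ[ℂ] L →ₗ[ℂ] Q) : Prop where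
  comm (x y : L) : q x y = q y x
  e_neg (x : M) (hx : x ∈ D.Φ) : (2 : ℂ) • q (D.e x) (D.e (-x)) = q (D.h x) (D.h x)
  e_h (x : M) (hx : x ∈ D.Φ) : q (D.e x) (D.h x) = 0
  e_e (x y z : M) (hx : x ∈ D.Φ) (hy : y ∈ D.Φ) (hxy : D.p x y = -1) (hz : z = x + y) :
    q (D.e x) (D.e y) = D.N x y • q (D.e z) (D.h x)
  square (w x y u v : M) (hw : w ∈ D.Φ) (hx : x ∈ D.Φ) (hy : y ∈ D.Φ) (hxy : D.p x y = 1)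
    (hwx : D.p w x = -1) (hwy : D.p w y = -1) (hu : u = w + x) (hv : v = w + y) :
    D.N w x • q (D.e u) (D.e y) + D.N w y • q (D.e x) (D.e v) = 0
  e_e_of_pos (x y : M) (hx : x ∈ D.Φ) (hy : y ∈ D.Φ) (hxy : 1 ≤ D.p x y) : q (D.e x) (D.e y) = 0

/-- The derivative of `q` along `l`. -/
def deriv (q : L →ₗ[ℂ] L →ₗ[ℂ] Q) (l x y : L) : Q := q ⁅l, x⁆ y + q x ⁅l, y⁆

variable {D} {q : L →ₗ[ℂ] L →ₗ[ℂ] Q} (hq : D.CartanRelations q)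

namespace CartanRelations

include hq

theorem e_h_of_add {x y z : M} (hz : z ∈ D.Φ) (h : z = x + y) :
    q (D.e z) (D.h x) = -q (D.e z) (D.h y) := by
  have := hq.e_h z hz
  rw [h, h_add, map_add, ← h] at this
  exact eq_neg_of_add_eq_zero_left this

theorem e_e_right (x y z : M) (hx : x ∈ D.Φ) (hy : y ∈ D.Φ) (hxy : D.p x y = -1) (hz : z = x + y) :
    q (D.e x) (D.e y) = D.N y x • q (D.e z) (D.h y) := by
  rw [hq.comm, hq.e_e y x z hy hx (by grind) (by rw [hz, add_comm])]

theorem deriv_comm (l x y : L) : deriv q l x y = deriv q l y x := by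
  rw [deriv, deriv, hq.comm, hq.comm x, add_comm]

omit hq in
theorem deriv_e_e_of_nonneg {l x y : M} (hl : l ∈ D.Φ) (hx : x ∈ D.Φ) (hy : y ∈ D.Φ)
    (hlx : 0 ≤ D.p l x) (hly : 0 ≤ D.p l y) : deriv q (D.e l) (D.e x) (D.e y) = 0 := by
  simp [deriv, D.lie_e_e_of_nonneg l x hl hx hlx, D.lie_e_e_of_nonneg l y hl hy hly]

omit hq in
theorem deriv_e_h {l z : M} (x : M) (hl : l ∈ D.Φ) :
    deriv q (D.e l) (D.e z) (D.h x) =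
      q ⁅D.e l, D.e z⁆ (D.h x) - (D.p l x : ℂ) • q (D.e z) (D.e l) := by
  rw [deriv, D.lie_e_h x l hl, map_smul, D.p_comm, neg_smul, sub_eq_add_neg]

/-- The two cases with real content are `l` pairing to `-1` with both roots, which is the square
relation when `x ≠ y`, and `l = -x`, where both terms are multiples of `q(e_y, h_x)` and cancel
because structure constants are signs. -/
theorem deriv_e_e_of_pos {l x y : M} (hl : l ∈ D.Φ) (hx : x ∈ D.Φ) (hy : y ∈ D.Φ)
    (hxy : 1 ≤ D.p x y) : deriv q (D.e l) (D.e x) (D.e y) = 0 := by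
  wlog hle : D.p l x ≤ D.p l y generalizing x y
  · rw [hq.deriv_comm]
    exact this hy hx (by grind) (by omega)
  rcases le_or_gt 0 (D.p l x) with h0 | h0
  · exact deriv_e_e_of_nonneg hl hx hy h0 (h0.trans hle)
  rw [deriv]
  have hself := D.p_self x hx
  obtain rfl | h1 | h1 | h1 | rfl := D.p_cases hl hx
  · omega
  · omega
  · omega
  · rw [D.lie_e_e hl hx h1 rfl]
    have hlx := D.add_mem l x hl hx h1
    rcases le_or_gt 0 (D.p l y) with h2 | h2
    · rw [D.lie_e_e_of_nonneg l y hl hy h2, map_zero, map_smul, LinearMap.smul_apply,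
        hq.e_e_of_pos _ y hlx hy (by grind), smul_zero, add_zero]
    · have h3 : D.p l y = -1 := by omega
      rw [D.lie_e_e hl hy h3 rfl, map_smul, map_smul, LinearMap.smul_apply]
      obtain rfl | h4 | h4 | h4 | rfl := D.p_cases hx hy
      · rw [hq.comm, hq.e_e_of_pos _ _ hx hlx (by grind), smul_zero, add_zero]
      · exact hq.square l x y _ _ hl hx hy h4 h1 h3 rfl rfl
      all_goals grind
  · obtain rfl | h4 | h4 | h4 | rfl := D.p_cases hx hy
    · rw [D.lie_e_neg_left hx, map_neg, map_neg, LinearMap.neg_apply, hq.comm, hq.e_h x hx]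
      simp
    · have hyx : y - x ∈ D.Φ := by
        rw [sub_eq_neg_add]
        exact D.add_mem _ _ hl hy (by grind)
      rw [D.lie_e_neg_left hx, D.lie_e_e (z := y - x) hl hy (by grind) (by abel), map_neg, map_smul,
        LinearMap.neg_apply, hq.e_e x (y - x) y hx hyx (by grind) (by abel),
        D.N_neg_add hx hyx (by grind) (by abel), hq.comm]
      linear_combination (norm := module) D.N_mul_self hx hyx (by grind) • q (D.e y) (D.h x)
    all_goals grind

theorem deriv_e_h_self {l x : M} (hl : l ∈ D.Φ) (hx : x ∈ D.Φ) :
    deriv q (D.e l) (D.e x) (D.h x) = 0 := by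
  rw [deriv_e_h x hl]
  have hself := D.p_self x hx
  obtain rfl | h1 | h1 | h1 | rfl := D.p_cases hl hx
  · rw [hq.e_e_of_pos _ _ hl hl (by omega), D.lie_e_e_of_nonneg l l hl hl (by omega)]
    simp
  · rw [hq.e_e_of_pos _ _ hx hl (by grind), D.lie_e_e_of_nonneg l x hl hx (by omega)]
    simp
  · rw [D.lie_e_e_of_nonneg l x hl hx (by omega), h1]
    simp
  · rw [D.lie_e_e hl hx h1 rfl, h1, map_smul, LinearMap.smul_apply,
      hq.e_e x l (l + x) hx hl (by grind) (by abel), D.N_comm hl hx h1]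
    push_cast
    module
  · rw [D.lie_e_neg_left hx, p_neg_left, hself, map_neg, LinearMap.neg_apply, ← hq.e_neg x hx]
    push_cast
    module

/-- For every value of the pairing of `l` and `x`, both sides reduce to multiples of `q(e_l, h_x)`.
-/
theorem deriv_e_neg {l x : M} (hl : l ∈ D.Φ) (hx : x ∈ D.Φ) :
    (2 : ℂ) • deriv q (D.e l) (D.e x) (D.e (-x)) = deriv q (D.e l) (D.h x) (D.h x) := by
  have hnx := D.neg_mem x hx
  have hself := D.p_self x hx
  have hr : deriv q (D.e l) (D.h x) (D.h x) = -(2 * D.p l x : ℂ) • q (D.e l) (D.h x) := by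
    rw [deriv, D.lie_e_h x l hl, hq.comm (D.h x), map_smul, D.p_comm, LinearMap.smul_apply]
    module
  rw [hr, deriv]
  obtain rfl | h1 | h1 | h1 | rfl := D.p_cases hl hx
  · rw [D.lie_e_neg l hl, hq.e_h l hl, D.lie_e_e_of_nonneg l l hl hl (by omega)]
    simp
  · have hlx : l - x ∈ D.Φ := by
      rw [sub_eq_add_neg]
      exact D.add_mem _ _ hl hnx (by grind)
    rw [D.lie_e_e_of_nonneg l x hl hx (by omega), D.lie_e_e (z := l - x) hl hnx
        (by grind) (by abel),
      map_smul, hq.e_e x (l - x) l hx hlx (by grind) (by abel), h1]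
    have h2 : D.N x (l - x) = -D.N l (-x) := by
      rw [D.N_cyc (z := -l) hx hlx (by grind) (by abel),
        D.N_cyc (z := x) hlx (D.neg_mem l hl) (by grind) (by abel),
        D.N_neg _ _ (D.neg_mem l hl) hx (by grind), neg_neg]
    rw [h2, map_zero, LinearMap.zero_apply]
    push_cast
    linear_combination (norm := module) (-2 * D.N_mul_self hl hnx (by grind)) • q (D.e l) (D.h x)
  · rw [D.lie_e_e_of_nonneg l x hl hx (by omega), D.lie_e_e_of_nonneg l (-x) hl hnx (by grind), h1]
    simp
  · rw [D.lie_e_e_of_nonneg l (-x) hl hnx (by grind), D.lie_e_e hl hx h1 rfl, map_smul,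
      LinearMap.smul_apply, hq.e_e_right (l + x) (-x) l (D.add_mem l x hl hx h1) hnx (by grind)
        (by abel), h1,
      D.N_neg_add hx hl (by grind) (add_comm l x), D.N_comm hl hx h1, D.h_neg, map_neg, map_zero]
    push_cast
    linear_combination (norm := module) (2 * D.N_mul_self hx hl (by grind)) • q (D.e l) (D.h x)
  · have h2 := hq.e_h _ hl
    rw [D.h_neg, map_neg, neg_eq_zero] at h2
    rw [D.lie_e_e_of_nonneg (-x) (-x) hl hl (by grind), D.lie_e_neg_left hx, map_neg,
      LinearMap.neg_apply, hq.comm, h2]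
    simp

end CartanRelations
end SimplyLacedData

/-! ### The derivative of the relation for two roots whose sum is a root. -/

namespace SimplyLacedData

variable {M L : Type*} [AddCommGroup M] [LieRing L] [LieAlgebra ℂ L] {D : SimplyLacedData M L}
variable {Q : Type*} [AddCommGroup Q] [Module ℂ Q] {q : L →ₗ[ℂ] L →ₗ[ℂ] Q}

namespace CartanRelations

theorem deriv_e_e (hq : D.CartanRelations q) {l x y z : M} (hl : l ∈ D.Φ) (hx : x ∈ D.Φ)
    (hy : y ∈ D.Φ) (hxy : D.p x y = -1) (hz : z = x + y) :
    deriv q (D.e l) (D.e x) (D.e y) = D.N x y • deriv q (D.e l) (D.e z) (D.h x) := by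
  have hz' : z ∈ D.Φ := hz ▸ D.add_mem x y hx hy hxy
  -- The relation is symmetric in `x` and `y` because differentiating `q(e_z, h_z) = 0` makes the
  -- derivatives of `q(e_z, h_x)` and `q(e_z, h_y)` opposite.
  wlog hle : D.p l y ≤ D.p l x generalizing x y
  · have h1 := this hy hx (by grind) (by rw [hz, add_comm]) (by omega)
    have h2 := hq.deriv_e_h_self hl hz'
    rw [hq.deriv_comm, h1, D.N_comm hy hx (by grind)]
    rw [hz, D.h_add, ← hz, deriv, lie_add, map_add, map_add] at h2
    rw [deriv, deriv]
    linear_combination (norm := module) D.N x y • -h2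
  have hself := D.p_self x hx
  have hself' := D.p_self y hy
  have hlz : D.p l z = D.p l x + D.p l y := by grind
  rw [deriv_e_h x hl, deriv]
  obtain rfl | h2 | h2 | h2 | rfl := D.p_cases hl hy
  · grind
  · have h1 : D.p l x = 1 := by
      obtain rfl | h1 | h1 | h1 | rfl := D.p_cases hl hx <;> grind
    rw [D.lie_e_e_of_nonneg l x hl hx (by omega), D.lie_e_e_of_nonneg l y hl hy (by omega),
      D.lie_e_e_of_nonneg l z hl hz' (by omega), hq.e_e_of_pos z l hz' hl (by grind)]
    simp
  · rw [D.lie_e_e_of_nonneg l x hl hx (by omega), D.lie_e_e_of_nonneg l y hl hy (by omega),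
      D.lie_e_e_of_nonneg l z hl hz' (by omega)]
    rcases hle.eq_or_lt with h | h
    · simp [← h, h2]
    · rw [hq.e_e_of_pos z l hz' hl (by grind)]
      simp
  · have hly := D.add_mem l y hl hy h2
    rw [D.lie_e_e hl hy h2 rfl]
    obtain rfl | h1 | h1 | h1 | rfl := D.p_cases hl hx
    · rw [D.lie_e_e_of_nonneg l l hl hl (by omega), D.lie_e_e_of_nonneg l z hl hz' (by omega),
        hq.e_e_of_pos z l hz' hl (by grind), map_smul, hq.e_e_of_pos l _ hl hly (by grind)]
      simp
    · rw [D.lie_e_e_of_nonneg l x hl hx (by omega), D.lie_e_e_of_nonneg l z hl hz' (by omega),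
        h1, map_smul, hq.comm (D.e x)]
      have h3 := hq.square y x l z (l + y) hy hx hl (by grind) (by grind) (by grind)
        (by rw [hz, add_comm]) (add_comm l y)
      rw [D.N_comm hy hx (by grind), D.N_comm hy hl (by grind), hq.comm (D.e x)] at h3
      push_cast
      rw [map_zero, LinearMap.zero_apply, LinearMap.zero_apply]
      linear_combination (norm := module) -h3
    · rw [D.lie_e_e_of_nonneg l x hl hx (by omega), D.lie_e_e (z := l + z) hl hz' (by grind) rfl,
        h1, map_smul, map_smul, LinearMap.smul_apply,
        hq.e_e x (l + y) (l + z) hx hly (by grind) (by rw [hz]; abel)]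
      have h3 := D.N_jacobi hx hl hy (by grind) hxy h2 hz rfl
      push_cast
      rw [map_zero, LinearMap.zero_apply]
      linear_combination (norm := module) -h3 • q (D.e (l + z)) (D.h x)
    -- Here the derivative has weight zero. The claim combines the relations `e_neg` for `x`, `y`
    -- and `z`, with `h_y = h_z - h_x` used to expand `q(h_y, h_y)`.
    · have hl2 : l = -z := D.eq_neg_of_p_eq_neg_two hl hz' (by grind)
      subst hl2
      have h3 : D.N (-z) x = D.N x y := by
        rw [D.N_cyc hl hx h1 (z := y) (by rw [hz]; abel)]
      have h4 : D.N (-z) y = -D.N x y := by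
        rw [D.N_cyc hl hy h2 (z := x) (by rw [hz]; abel), D.N_comm hy hx (by grind)]
      have e1 := hq.e_neg x hx
      have e2 := hq.e_neg y hy
      have e3 := hq.e_neg z hz'
      have e4 : D.h y = D.h z - D.h x := by rw [hz, h_add]; abel
      rw [D.lie_e_neg_left hz', D.lie_e_e (z := -y) hl hx h1 (by rw [hz]; abel), hz]
      rw [show -(x + y) + y = -x by abel, ← hz, h3, h4, h1]
      simp only [map_smul, map_neg, LinearMap.smul_apply, LinearMap.neg_apply, hq.comm (D.e (-y))]
      simp only [e4, map_sub, LinearMap.sub_apply, hq.comm (D.h x) (D.h z)] at e2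
      push_cast
      linear_combination (norm := module) (D.N x y / 2) • (e2 - e1 - e3)
    · grind
  · have h1 : D.p y x = -1 := by grind
    have hxz : D.p z y = 1 := by grind
    have h3 : D.N (-y) z = -D.N x y := by
      rw [D.N_neg_add hy hx h1 (by rw [hz, add_comm]), D.N_comm hy hx h1]
    have h4 : D.N z (-y) = D.N x y := by
      rw [D.N_comm hz' hl (by grind), h3, neg_neg]
    have h5 := hq.e_h x hx
    have h6 : D.h y = D.h z - D.h x := by rw [hz, h_add]; abel
    rw [D.lie_e_neg_left hy, D.lie_e_e_of_nonneg (-y) x hl hx (by grind),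
      D.lie_e_e (z := x) hl hz' (by grind) (by rw [hz]; abel), h3,
      hq.e_e z (-y) x hz' hl (by grind) (by rw [hz]; abel), h4, p_neg_left, h1]
    simp only [map_smul, map_neg, LinearMap.smul_apply, map_zero, LinearMap.zero_apply, h6, map_sub]
    push_cast
    rw [h5]
    linear_combination (norm := module) D.N_mul_self hx hy hxy • q (D.e x) (D.h z)

end CartanRelations
end SimplyLacedData

/-! ### The derivative of the square relation. -/

namespace SimplyLacedData

variable {M L : Type*} [AddCommGroup M] [LieRing L] [LieAlgebra ℂ L] {D : SimplyLacedData M L}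
variable {Q : Type*} [AddCommGroup Q] [Module ℂ Q] {q : L →ₗ[ℂ] L →ₗ[ℂ] Q}

namespace CartanRelations

/-- Taking `y` to be the corner of the square with least pairing with `l` leaves few cases: if that
pairing is nonnegative, `e_l` kills every term, and otherwise it is `-1` or `l = -y`. -/
theorem deriv_square_of_le (hq : D.CartanRelations q) {l w x y u v : M} (hl : l ∈ D.Φ)
    (hw : w ∈ D.Φ) (hx : x ∈ D.Φ) (hy : y ∈ D.Φ) (hxy : D.p x y = 1) (hwx : D.p w x = -1)
    (hwy : D.p w y = -1) (hu : u = w + x) (hv : v = w + y) (hlu : D.p l y ≤ D.p l u)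
    (hlv : D.p l y ≤ D.p l v) (hlx : D.p l y ≤ D.p l x) :
    D.N w x • deriv q (D.e l) (D.e u) (D.e y) + D.N w y • deriv q (D.e l) (D.e x) (D.e v) = 0 := by
  have hu' : u ∈ D.Φ := hu ▸ D.add_mem w x hw hx hwx
  have hv' : v ∈ D.Φ := hv ▸ D.add_mem w y hw hy hwy
  have hxs := D.p_self x hx
  have hys := D.p_self y hy
  have hws := D.p_self w hw
  have hpu : D.p l u = D.p l w + D.p l x := by grind
  have hpv : D.p l v = D.p l w + D.p l y := by grind
  rcases le_or_gt 0 (D.p l y) with h0 | h0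
  · rw [deriv_e_e_of_nonneg hl hu' hy (h0.trans hlu) h0,
      deriv_e_e_of_nonneg hl hx hv' (h0.trans hlx) (h0.trans hlv), smul_zero, smul_zero, add_zero]
  rw [deriv, deriv]
  obtain rfl | h1 | h1 | h1 | rfl := D.p_cases hl hy
  · omega
  · omega
  · omega
  · have hly := D.add_mem l y hl hy h1
    rw [D.lie_e_e hl hy h1 rfl]
    obtain rfl | h2 | h2 | h2 | rfl := D.p_cases hl hw
    · rw [D.lie_e_e_of_nonneg l u hl hu' (by omega), D.lie_e_e_of_nonneg l v hl hv' (by omega),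
        D.lie_e_e hl hx hwx rfl]
      simp only [map_smul, LinearMap.smul_apply, map_zero, LinearMap.zero_apply]
      rw [hq.e_e_of_pos u _ hu' hly (by grind), hq.e_e_of_pos _ v (hu ▸ hu') hv' (by grind)]
      simp
    · obtain rfl | h3 | h3 | h3 | rfl := D.p_cases hl hx
      · omega
      · rw [D.lie_e_e_of_nonneg l u hl hu' (by omega), D.lie_e_e_of_nonneg l v hl hv' (by omega),
          D.lie_e_e_of_nonneg l x hl hx (by omega), map_smul, hq.e_e_of_pos u _ hu' hly (by grind)]
        simp
      · rw [D.lie_e_e_of_nonneg l u hl hu' (by omega), D.lie_e_e_of_nonneg l v hl hv' (by omega),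
          D.lie_e_e_of_nonneg l x hl hx (by omega), map_smul, hq.e_e_of_pos u _ hu' hly (by grind)]
        simp
      · rw [D.lie_e_e_of_nonneg l u hl hu' (by omega), D.lie_e_e_of_nonneg l v hl hv' (by omega),
          D.lie_e_e hl hx h3 rfl]
        -- The derivative is a multiple of the square relation with side `w - l` and corners `l +
        -- x`, `l + y`, `u`, `v`. The identities `e7` and `e8` express the old constants through the
        -- new ones.
        have hwl : w - l ∈ D.Φ := by
          rw [sub_eq_add_neg]
          exact D.add_mem _ _ hw (D.neg_mem l hl) (by grind)
        have hls := D.p_self l hl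
        have e1 := hq.square (w - l) (l + x) (l + y) u v hwl (D.add_mem l x hl hx h3) hly
          (by grind) (by grind) (by grind) (by rw [hu]; abel) (by rw [hv]; abel)
        have e2 := D.N_jacobi' (u := w) (v := l + x) hwl hx hl (by grind) (by grind) (by grind)
          (by abel) rfl
        have e3 := D.N_jacobi' (u := w) (v := l + y) hwl hy hl (by grind) (by grind) (by grind)
          (by abel) rfl
        have e4 := D.N_mul_self hwl hl (by grind)
        have e5 := D.N_mul_self hl hx h3
        have e6 := D.N_mul_self hl hy h1
        simp only [map_smul, LinearMap.smul_apply, map_zero, LinearMap.zero_apply]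
        have e7 : D.N w x = D.N (w - l) l * (D.N l x * D.N (w - l) (l + x)) := by
          linear_combination -D.N w x * e4 + D.N (w - l) l * e2
        have e8 : D.N w y = D.N (w - l) l * (D.N l y * D.N (w - l) (l + y)) := by
          linear_combination -D.N w y * e4 + D.N (w - l) l * e3
        rw [e7, e8]
        linear_combination (norm := module) (D.N (w - l) l * D.N l x * D.N l y) • e1
      · grind
    · have e2 := D.N_jacobi hl hw hy h2 h1 hwy rfl hv
      have e3 := hq.square w x (l + y) u (l + v) hw hx hly
      obtain rfl | h3 | h3 | h3 | rfl := D.p_cases hl hx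
      · omega
      · rw [D.lie_e_e_of_nonneg l u hl hu' (by omega), D.lie_e_e (z := l + v) hl hv' (by grind) rfl,
          D.lie_e_e_of_nonneg l x hl hx (by omega), map_smul, map_smul,
          hq.e_e_of_pos u _ hu' hly (by grind),
          hq.e_e_of_pos x _ hx (D.add_mem l v hl hv' (by grind)) (by grind)]
        simp
      · rw [D.lie_e_e_of_nonneg l u hl hu' (by omega), D.lie_e_e (z := l + v) hl hv' (by grind) rfl,
          D.lie_e_e_of_nonneg l x hl hx (by omega)]
        -- As `l` is orthogonal to `w` and `x`, adding `l` to `y` and `v` gives another square with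
        -- the same side `w`.
        have e4 := e3 (by grind) hwx (by grind) hu (by rw [hv]; abel)
        simp only [map_smul, map_zero, LinearMap.zero_apply]
        linear_combination (norm := module)
          D.N l y • e4 - e2 • q (D.e x) (D.e (l + v))
      · have hlv1 : D.p l v = -1 := by omega
        have hlu1 : D.p l u = -1 := by omega
        rw [D.lie_e_e hl hu' hlu1 rfl, D.lie_e_e hl hv' hlv1 rfl, D.lie_e_e hl hx h3 rfl]
        have hlu := D.add_mem l u hl hu' hlu1
        have hlv := D.add_mem l v hl hv' hlv1
        have hlx := D.add_mem l x hl hx h3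
        have hls := D.p_self l hl
        -- All four terms land on the root `l + u + y`, so they become multiples of `q(e_{l+u+y},
        -- ·)` evaluated at `h_w`, `h_x`, `h_y`. What remains is the identities `m1`, `m2`, `m3`
        -- between structure constants.
        have f1 := hq.e_e_right (l + u) y (l + u + y) hlu hy (by grind) rfl
        have f2 := hq.e_e u (l + y) (l + u + y) hu' hly (by grind) (by abel)
        have f3 := hq.e_e_right (l + x) v (l + u + y) hlx hv' (by grind) (by rw [hu, hv]; abel)
        have f4 := hq.e_e x (l + v) (l + u + y) hx hlv (by grind) (by rw [hu, hv]; abel)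
        have g1 : D.h u = D.h w + D.h x := by rw [hu, h_add]
        have g2 : D.h v = D.h w + D.h y := by rw [hv, h_add]
        simp only [map_smul, LinearMap.smul_apply, f1, f2, f3, f4, g1, g2, map_add]
        have k1 := D.N_jacobi (u := l + u) (v := l + y) hu' hy hl (by grind) (by grind) (by grind)
          (add_comm l u) (add_comm l y)
        have k2 := D.N_jacobi (u := l + v) (v := l + x) hv' hx hl (by grind) (by grind) (by grind)
          (add_comm l v) (add_comm l x)
        have k3 := D.N_jacobi' (u := u) (v := l + v) (x := x) (y := l + y) (z := w) hx hly hw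
          (by grind) (by grind) (by grind) (by rw [hu, add_comm]) (by rw [hv]; abel)
        rw [D.N_comm hu' hl (by grind), D.N_comm hy hl (by grind)] at k1
        rw [D.N_comm hv' hl (by grind), D.N_comm hx hl (by grind)] at k2
        rw [D.N_comm hx hw (by grind)] at k3
        have m1 : D.N w x * (D.N l u * D.N y (l + u)) = D.N w x * (D.N l y * D.N u (l + y)) := by
          linear_combination -D.N w x * k1
        have m2 : D.N w y * (D.N l x * D.N v (l + x)) = D.N w y * (D.N l v * D.N x (l + v)) := by
          linear_combination D.N w y * k2
        have m3 : D.N w x * (D.N l y * D.N u (l + y)) = -(D.N w y * (D.N l v * D.N x (l + v))) := by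
          linear_combination -D.N l y * k3 - D.N x (l + v) * e2
        linear_combination (norm := module)
          m1 • q (D.e (l + u + y)) (D.h y)
            + m2 • (q (D.e (l + u + y)) (D.h w) + q (D.e (l + u + y)) (D.h y))
            + m3 • (q (D.e (l + u + y)) (D.h w) + q (D.e (l + u + y)) (D.h x)
              + q (D.e (l + u + y)) (D.h y))
      · grind
    · grind
    · grind
  · have hxv : x - y ∈ D.Φ := by
      rw [sub_eq_add_neg]
      exact D.add_mem _ _ hx hl (by grind)
    rw [D.lie_e_neg_left hy, D.lie_e_e_of_nonneg (-y) u hl hu' (by grind),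
      D.lie_e_e (z := x - y) hl hx (by grind) (by abel),
      D.lie_e_e (z := w) hl hv' (by grind) (by rw [hv]; abel)]
    have f1 := hq.e_e (x - y) v u hxv hv' (by grind) (by rw [hu, hv]; abel)
    have f2 := hq.e_e x w u hx hw (by grind) (by rw [hu, add_comm])
    simp only [map_smul, LinearMap.smul_apply, f1, f2, map_neg, map_zero, LinearMap.zero_apply,
      h_sub, map_sub]
    have k1 := D.N_jacobi hxv hw hy (by grind) (by grind) hwy (by abel : x = x - y + y) hv
    have k2 := D.N_neg_add hy hxv (by grind) (by abel : x = y + (x - y))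
    have k3 := D.N_neg_add hy hw (by grind) (by rw [hv, add_comm] : v = y + w)
    have k4 := D.N_mul_self hy hxv (by grind)
    have k5 := D.N_mul_self hy hw (by grind)
    rw [k2, k3, D.N_comm hw hy (by grind), D.N_comm hx hw (by grind)]
    rw [D.N_comm hxv hy (by grind), D.N_comm hw hy (by grind)] at k1
    linear_combination (norm := module)
      (D.N w x * k4 + D.N y (x - y) * k1) • (q (D.e u) (D.h y) - q (D.e u) (D.h x))
       + (D.N w x * k5) • q (D.e u) (D.h x)

theorem deriv_square (hq : D.CartanRelations q) {l w x y u v : M} (hl : l ∈ D.Φ)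
    (hw : w ∈ D.Φ) (hx : x ∈ D.Φ) (hy : y ∈ D.Φ) (hxy : D.p x y = 1) (hwx : D.p w x = -1)
    (hwy : D.p w y = -1) (hu : u = w + x) (hv : v = w + y) :
    D.N w x • deriv q (D.e l) (D.e u) (D.e y) + D.N w y • deriv q (D.e l) (D.e x) (D.e v) = 0 := by
  -- Up to the symmetries of the square, `y` minimizes `D.p l`.
  wlog hyx : D.p l y ≤ D.p l x generalizing x y u v
  · have := this hy hx (by grind) hwy hwx hv hu (by omega)
    rwa [hq.deriv_comm _ (D.e v), hq.deriv_comm _ (D.e y), add_comm] at this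
  have hpu : D.p l u = D.p l w + D.p l x := by grind
  have hpv : D.p l v = D.p l w + D.p l y := by grind
  rcases le_total 0 (D.p l w) with h | h
  · exact hq.deriv_square_of_le hl hw hx hy hxy hwx hwy hu hv (by omega) (by omega) hyx
  · have hws := D.p_self w hw
    -- Read the same square backwards, with side `-w` from `u, v` to `x, y`. The two forms of the
    -- relation differ by the sign `N w x * N w y`.
    have h1 := hq.deriv_square_of_le (w := -w) (x := u) (y := v) (u := x) (v := y) hl
      (D.neg_mem w hw) (hu ▸ D.add_mem w x hw hx hwx) (hv ▸ D.add_mem w y hw hy hwy)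
      (by grind) (by grind) (by grind) (by rw [hu]; abel) (by rw [hv]; abel) (by omega) (by omega)
      (by omega)
    rw [D.N_neg_add hw hx hwx hu, D.N_neg_add hw hy hwy hv] at h1
    have h2 := D.N_mul_self hw hx hwx
    have h3 := D.N_mul_self hw hy hwy
    linear_combination (norm := module) (D.N w x * D.N w y) • h1
      - (D.N w y * h2) • deriv q (D.e l) (D.e x) (D.e v)
      - (D.N w x * h3) • deriv q (D.e l) (D.e u) (D.e y)

end CartanRelations
end SimplyLacedData

/-! ### Deriving all relations from one vanishing square in an equivariant quotient. -/

namespace SimplyLacedData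

variable {M L : Type*} [AddCommGroup M] [LieRing L] [LieAlgebra ℂ L] {D : SimplyLacedData M L}

section Equivariant

variable {Q : Type*} [AddCommGroup Q] [Module ℂ Q] [LieRingModule L Q]
variable {q : L →ₗ[ℂ] L →ₗ[ℂ] Q}

section

variable (hcomm : ∀ x y, q x y = q y x) (hlie : ∀ l x y, ⁅l, q x y⁆ = deriv q l x y)

include hcomm hlie

/-- Apply `e_{x-y}` to `q(e_y, e_y) = 0`; a second application gives `q(e_x, e_x) = 0` in the next
lemma. -/
theorem q_e_e_of_p_eq_one {x y : M} (hx : x ∈ D.Φ) (hy : y ∈ D.Φ) (hxy : D.p x y = 1)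
    (h : q (D.e y) (D.e y) = 0) : q (D.e x) (D.e y) = 0 := by
  have hys := D.p_self y hy
  have hw : x - y ∈ D.Φ := by
    rw [sub_eq_add_neg]
    exact D.add_mem _ _ hx (D.neg_mem y hy) (by grind)
  have h1 := congrArg (fun t => ⁅D.e (x - y), t⁆) h
  simp only [hlie, deriv, lie_zero] at h1
  rw [D.lie_e_e (z := x) hw hy (by grind) (by abel), map_smul, map_smul, LinearMap.smul_apply,
    hcomm (D.e y), ← two_smul ℂ, smul_smul] at h1
  exact (smul_eq_zero.mp h1).resolve_left
    (mul_ne_zero two_ne_zero (D.N_ne_zero hw hy (by grind)))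

theorem q_e_self_of_p_eq_one {x y : M} (hx : x ∈ D.Φ) (hy : y ∈ D.Φ) (hxy : D.p x y = 1)
    (h : q (D.e y) (D.e y) = 0) : q (D.e x) (D.e x) = 0 := by
  have hxs := D.p_self x hx
  have hys := D.p_self y hy
  have hw : x - y ∈ D.Φ := by
    rw [sub_eq_add_neg]
    exact D.add_mem _ _ hx (D.neg_mem y hy) (by grind)
  have h1 := congrArg (fun t => ⁅D.e (x - y), t⁆) (q_e_e_of_p_eq_one hcomm hlie hx hy hxy h)
  simp only [hlie, deriv, lie_zero] at h1
  rw [D.lie_e_e (z := x) hw hy (by grind) (by abel), D.lie_e_e_of_nonneg _ x hw hx (by grind),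
    map_zero, LinearMap.zero_apply, zero_add, map_smul] at h1
  exact (smul_eq_zero.mp h1).resolve_left (D.N_ne_zero hw hy (by grind))

theorem q_e_h {x : M} (hx : x ∈ D.Φ) (h : q (D.e x) (D.e x) = 0) : q (D.e x) (D.h x) = 0 := by
  have h1 := congrArg (fun t => ⁅D.e (-x), t⁆) h
  simp only [hlie, deriv, lie_zero] at h1
  rw [D.lie_e_neg_left hx, map_neg, map_neg, LinearMap.neg_apply, hcomm (D.h x)] at h1
  linear_combination (norm := module) (-1 / 2 : ℂ) • h1

theorem q_e_neg {x : M} (hx : x ∈ D.Φ) (h : q (D.e x) (D.e x) = 0) :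
    (2 : ℂ) • q (D.e x) (D.e (-x)) = q (D.h x) (D.h x) := by
  have h1 := congrArg (fun t => ⁅D.e (-x), t⁆) (q_e_h hcomm hlie hx h)
  simp only [hlie, deriv, lie_zero] at h1
  rw [D.lie_e_neg_left hx, D.lie_e_h _ _ (D.neg_mem x hx), p_neg_right, D.p_self x hx, map_neg,
    map_smul, LinearMap.neg_apply] at h1
  push_cast at h1
  linear_combination (norm := module) h1

/-- Repeated lowering by `e_{-x}` runs down the `sl₂`-string of `e_x e_x`, whose last term is a
multiple of `e_{-x} e_{-x}`. -/
theorem q_e_self_neg [LieModule ℂ L Q] {x : M} (hx : x ∈ D.Φ) (h : q (D.e x) (D.e x) = 0) :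
    q (D.e (-x)) (D.e (-x)) = 0 := by
  have hnx := D.neg_mem x hx
  have hlh : ⁅D.e (-x), D.h x⁆ = (2 : ℂ) • D.e (-x) := by
    rw [D.lie_e_h _ _ hnx, p_neg_right, D.p_self x hx]
    norm_num
  have h1 := congrArg (fun t => ⁅D.e (-x), t⁆) (q_e_neg hcomm hlie hx h)
  simp only [hlie, deriv, lie_smul] at h1
  rw [D.lie_e_neg_left hx, lie_self, hlh, map_neg, map_smul, map_zero, map_smul,
    LinearMap.neg_apply, LinearMap.smul_apply, hcomm (D.h x)] at h1
  have h2 : q (D.e (-x)) (D.h x) = 0 := by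
    linear_combination (norm := module) (-1 / 6 : ℂ) • h1
  have h3 := congrArg (fun t => ⁅D.e (-x), t⁆) h2
  simp only [hlie, deriv, lie_zero] at h3
  rw [lie_self, hlh, map_zero, LinearMap.zero_apply, map_smul] at h3
  linear_combination (norm := module) (1 / 2 : ℂ) • h3

theorem cartanRelations_of_forall (h : ∀ x ∈ D.Φ, q (D.e x) (D.e x) = 0) :
    D.CartanRelations q where
  comm := hcomm
  e_neg x hx := q_e_neg hcomm hlie hx (h x hx)
  e_h x hx := q_e_h hcomm hlie hx (h x hx)
  e_e x y z hx hy hxy hz := by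
    have hz' : z ∈ D.Φ := hz ▸ D.add_mem x y hx hy hxy
    have h1 := congrArg (fun t => ⁅D.e x, t⁆) (q_e_h hcomm hlie hy (h y hy))
    have h2 := q_e_h hcomm hlie hz' (h z hz')
    simp only [hlie, deriv, lie_zero] at h1
    rw [D.lie_e_e hx hy hxy hz, D.lie_e_h y x hx, D.p_comm, hxy, map_smul, map_smul,
      hcomm (D.e y), LinearMap.smul_apply] at h1
    rw [hz, h_add, ← hz, map_add] at h2
    push_cast at h1
    linear_combination (norm := module) h1 - D.N x y • h2
  square w x y u v hw hx hy hxy hwx hwy hu hv := by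
    have h1 := congrArg (fun t => ⁅D.e w, t⁆) (q_e_e_of_p_eq_one hcomm hlie hx hy hxy (h y hy))
    simp only [hlie, deriv, lie_zero] at h1
    rwa [D.lie_e_e hw hx hwx hu, D.lie_e_e hw hy hwy hv, map_smul, map_smul,
      LinearMap.smul_apply] at h1
  e_e_of_pos x y hx hy hxy := by
    obtain rfl | h1 | h1 | h1 | rfl := D.p_cases hx hy
    · exact h x hx
    · exact q_e_e_of_p_eq_one hcomm hlie hx hy h1 (h y hy)
    · omega
    · omega
    · have := D.p_self y hy
      grind

end

/-- A set of roots which contains every root that is not orthogonal to it is everything. -/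
def IsConnected (D : SimplyLacedData M L) : Prop :=
  ∀ S ⊆ D.Φ, S.Nonempty → (∀ x ∈ S, ∀ y ∈ D.Φ, D.p x y ≠ 0 → y ∈ S) → S = D.Φ

/-- The set of roots with `q(e_x, e_x) = 0` is closed under passing to a non-orthogonal root. A
pairing of `-1` is reduced to `1` by first replacing `x` with `-x`. -/
theorem cartanRelations_of_isConnected [LieModule ℂ L Q] (hcomm : ∀ x y, q x y = q y x)
    (hlie : ∀ l x y, ⁅l, q x y⁆ = deriv q l x y) (hD : D.IsConnected) {w : M} (hw : w ∈ D.Φ)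
    (h : q (D.e w) (D.e w) = 0) : D.CartanRelations q := by
  have hS := hD {x ∈ D.Φ | q (D.e x) (D.e x) = 0} (Set.sep_subset _ _) ⟨w, hw, h⟩ ?_
  · exact cartanRelations_of_forall hcomm hlie fun x hx => (hS.ge hx).2
  rintro x ⟨hx, h1⟩ y hy hxy
  refine ⟨hy, ?_⟩
  obtain rfl | h2 | h2 | h2 | rfl := D.p_cases hx hy
  · exact h1
  · exact q_e_self_of_p_eq_one hcomm hlie hy hx (by grind) h1
  · exact absurd h2 hxy
  · exact q_e_self_of_p_eq_one hcomm hlie hy (D.neg_mem x hx) (by grind)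
      (q_e_self_neg hcomm hlie hx h1)
  · simpa using q_e_self_neg hcomm hlie hx h1

end Equivariant

end SimplyLacedData

/-! ### Equality of root lengths in the simply laced case. -/

namespace RootPairing

variable {ι R M N : Type*} [Finite ι] [CommRing R] [CharZero R] [IsDomain R]
  [AddCommGroup M] [Module R M] [AddCommGroup N] [Module R N] {P : RootPairing ι R M N}
  [P.IsCrystallographic] [P.IsReduced] [P.IsIrreducible]

/-- Reflections preserve length and move every root to a simple one. Adjacent simple roots have both
Cartan entries `-1`, hence equal lengths, and the Dynkin diagram is connected. -/
theorem InvariantForm.apply_self_eq_of_isSimplyLaced (F : P.InvariantForm) (b : P.Base)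
    (hb : b.cartanMatrix.IsSimplyLaced) (i j : ι) :
    F.form (P.root i) (P.root i) = F.form (P.root j) (P.root j) := by
  have : Nonempty ι := ⟨i⟩
  obtain ⟨k, hk⟩ := b.support_nonempty
  suffices ∀ i, F.form (P.root i) (P.root i) = F.form (P.root k) (P.root k) by rw [this i, this j]
  have hrefl (i j : ι) : F.form (P.root (P.reflectionPerm j i)) (P.root (P.reflectionPerm j i)) =
      F.form (P.root i) (P.root i) := by
    rw [root_reflectionPerm, F.apply_reflection_reflection]
  clear i j
  intro i
  refine b.induction_reflect i
    (p := fun i => F.form (P.root i) (P.root i) = F.form (P.root k) (P.root k))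
    (fun i h => by rw [hrefl, h]) (fun i hi => ?_)
    (fun i j h _ => by rw [hrefl, h])
  refine b.induction_on_cartanMatrix (i := ⟨k, hk⟩) (j := ⟨i, hi⟩)
    (fun l => F.form (P.root l) (P.root l) = F.form (P.root k) (P.root k)) rfl ?_
  rintro l m hl hml
  rcases eq_or_ne m l with rfl | hne
  · exact hl
  have h1 := (hb hne).resolve_left hml
  have h2 := (hb hne.symm).resolve_left fun h0 => hml (b.cartanMatrix_apply_eq_zero_iff_symm.mp h0)
  have h3 := F.pairing_mul_eq_pairing_mul_swap l m
  simp only [Base.cartanMatrix, Base.cartanMatrixIn_def] at h1 h2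
  rw [← P.algebraMap_pairingIn ℤ, ← P.algebraMap_pairingIn ℤ, h1, h2] at h3
  rw [← hl]
  simpa using h3.symm

omit [Finite ι] [IsDomain R] [P.IsReduced] [P.IsIrreducible] in
theorem Base.isSimplyLaced_flip (b : P.Base) (hb : b.cartanMatrix.IsSimplyLaced) :
    b.flip.cartanMatrix.IsSimplyLaced := by
  intro i j hij
  have h1 : b.flip.cartanMatrix i j = b.cartanMatrix j i := by
    change P.flip.pairingIn ℤ i j = P.pairingIn ℤ j i
    apply (algebraMap ℤ R).injective_int
    rw [algebraMap_pairingIn, algebraMap_pairingIn]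
    rfl
  rw [h1]
  exact hb hij.symm

end RootPairing

/-! ### Coroots, the form `κ` and the root lattice. -/

namespace SymSquare

open LieAlgebra LieAlgebra.IsKilling LieModule

variable {L : Type*} [LieRing L] [LieAlgebra ℂ L] [FiniteDimensional ℂ L]
  {H : LieSubalgebra ℂ L} [H.IsCartanSubalgebra]

section Simple

variable [LieAlgebra.IsSimple ℂ L]

/-- Apply the length lemma to the dual root system, whose canonical form is the Killing form on the
Cartan subalgebra. -/
theorem killingForm_hc_self_eq (b : (rootSystem H).Base) (hb : b.cartanMatrix.IsSimplyLaced)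
    (α β : H.root) : killingForm ℂ L (hc α) (hc α) = killingForm ℂ L (hc β) (hc β) := by
  have h := (rootSystem H).flip.toInvariantForm.apply_self_eq_of_isSimplyLaced b.flip
    (b.isSimplyLaced_flip hb) α β
  change (rootSystem H).CorootForm (coroot α.1) (coroot α.1) =
    (rootSystem H).CorootForm (coroot β.1) (coroot β.1) at h
  rw [corootForm_rootSystem_eq_killing] at h
  exact h

end Simple

variable [IsKilling ℂ L]

/-- The linear extension to `H*` of the map sending a root to its coroot. -/
noncomputable def corootMap (ω : H.root) : Module.Dual ℂ H →ₗ[ℂ] H :=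
  (killingForm ℂ L (hc ω) (hc ω) / 2) • (cartanEquivDual H).symm.toLinearMap

omit [IsKilling ℂ L] in
theorem isNonZero (α : H.root) : α.1.IsNonZero := by simpa using (Finset.mem_filter.mp α.2).2

omit [FiniteDimensional ℂ L] [H.IsCartanSubalgebra] [IsKilling ℂ L] in
theorem traceForm_eq_killingForm (x y : H) : traceForm ℂ H L x y = killingForm ℂ L x y := rfl

/-- The coroot is the Killing dual of the root times a factor depending only on the length. With
equal lengths the factor is common, so root to coroot extends linearly. -/
theorem corootMap_root {ω α : H.root}
    (h : killingForm ℂ L (hc α) (hc α) = killingForm ℂ L (hc ω) (hc ω)) :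
    corootMap ω ((rootSystem H).root α) = coroot α.1 := by
  have h1 := traceForm_coroot α.1 (coroot α.1)
  rw [root_apply_coroot (isNonZero α), traceForm_eq_killingForm] at h1
  change killingForm ℂ L (hc α) (hc α) = _ at h1
  rw [corootMap, ← h, h1, rootSystem_root_apply, coroot]
  simp only [LinearMap.smul_apply, LinearEquiv.coe_coe, nsmul_eq_mul, smul_eq_mul]
  module

theorem traceForm_cartanEquivDual_symm (x : Module.Dual ℂ H) (y : H) :
    traceForm ℂ H L ((cartanEquivDual H).symm x) y = x y :=
  LinearMap.congr_fun ((cartanEquivDual H).apply_symm_apply x) y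

theorem corootMap_comm (ω : H.root) (x y : Module.Dual ℂ H) :
    y (corootMap ω x) = x (corootMap ω y) := by
  simp only [corootMap, LinearMap.smul_apply, LinearEquiv.coe_coe, map_smul]
  rw [← traceForm_cartanEquivDual_symm y, ← traceForm_cartanEquivDual_symm x]
  congr 1
  exact LieModule.traceForm_comm ..

theorem hc_ne_zero (α : H.root) : hc α ≠ 0 := by
  intro h
  have h1 : coroot α.1 = 0 := Subtype.ext h
  exact isNonZero α (coroot_eq_zero_iff.mp h1)

theorem root_negRoot (α : H.root) :
    (rootSystem H).root (negRoot α) = -(rootSystem H).root α := by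
  ext x
  simp [negRoot]

theorem kappa_eq {ω : H.root}
    (h : ∀ α : H.root, killingForm ℂ L (hc α) (hc α) = killingForm ℂ L (hc ω) (hc ω))
    (α β : H.root) : kappa ω α β = (rootSystem H).pairing α β := by
  have h1 := traceForm_coroot ω.1 (coroot ω.1)
  have h0 := root_apply_cartanEquivDual_symm_ne_zero (isNonZero ω)
  rw [root_apply_coroot (isNonZero ω), traceForm_eq_killingForm] at h1
  change killingForm ℂ L (hc ω) (hc ω) = _ at h1
  have hne : killingForm ℂ L (hc ω) (hc ω) ≠ 0 := by
    rw [h1]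
    simpa using h0
  have h2 : killingForm ℂ L (hc α) (hc β) =
      killingForm ℂ L (hc ω) (hc ω) / 2 * (rootSystem H).pairing α β := by
    have h3 : traceForm ℂ H L (corootMap ω ((rootSystem H).root α)) (coroot β.1) =
        killingForm ℂ L (hc ω) (hc ω) / 2 * (rootSystem H).root α (coroot β.1) := by
      rw [corootMap, LinearMap.smul_apply, map_smul, LinearMap.smul_apply, LinearEquiv.coe_coe,
        traceForm_cartanEquivDual_symm, smul_eq_mul]
    rw [corootMap_root (h α)] at h3
    exact h3
  rw [kappa, kappaForm, LinearMap.smul_apply, LinearMap.smul_apply, h2, smul_eq_mul]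
  field_simp

/-- The lattice generated by the roots. -/
noncomputable abbrev rootLattice (H : LieSubalgebra ℂ L) [H.IsCartanSubalgebra] :
    AddSubgroup (Module.Dual ℂ H) :=
  AddSubgroup.closure (Set.range (rootSystem H).root)

/-- A root as an element of the root lattice. -/
noncomputable def latticeRoot (α : H.root) : rootLattice H :=
  ⟨(rootSystem H).root α, AddSubgroup.subset_closure ⟨α, rfl⟩⟩

theorem latticeRoot_injective : Function.Injective (latticeRoot (H := H)) := fun _ _ h =>
  (rootSystem H).root.injective (congrArg Subtype.val h)

/-- The integral form on the root lattice for which the coroot of `ω` has square length two. -/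
noncomputable def latticeForm (ω : H.root) (x y : rootLattice H) : ℤ :=
  round (y.1 (corootMap ω x.1)).re

/-- On roots the complex value is a Cartan integer, and by biadditivity it is an integer on the
whole lattice, so rounding changes nothing. -/
theorem latticeForm_cast {ω : H.root}
    (h : ∀ α : H.root, killingForm ℂ L (hc α) (hc α) = killingForm ℂ L (hc ω) (hc ω))
    (x y : rootLattice H) : (latticeForm ω x y : ℂ) = y.1 (corootMap ω x.1) := by
  suffices ∃ n : ℤ, y.1 (corootMap ω x.1) = n by
    obtain ⟨n, hn⟩ := this
    rw [latticeForm, hn]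
    simp
  obtain ⟨x, hx⟩ := x
  obtain ⟨y, hy⟩ := y
  induction hx using AddSubgroup.closure_induction with
  | mem x hx =>
    obtain ⟨α, rfl⟩ := hx
    simp only [corootMap_root (h α)]
    induction hy using AddSubgroup.closure_induction with
    | mem y hy =>
      obtain ⟨β, rfl⟩ := hy
      exact ⟨(rootSystem H).pairingIn ℤ β α, ((rootSystem H).algebraMap_pairingIn ℤ β α).symm⟩
    | zero => exact ⟨0, by simp⟩
    | add y z _ _ hy hz =>
      obtain ⟨m, hm⟩ := hy
      obtain ⟨n, hn⟩ := hz
      exact ⟨m + n, by simp_all⟩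
    | neg y _ hy =>
      obtain ⟨m, hm⟩ := hy
      exact ⟨-m, by simp_all⟩
  | zero => exact ⟨0, by simp⟩
  | add y z _ _ hy hz =>
    obtain ⟨m, hm⟩ := hy
    obtain ⟨n, hn⟩ := hz
    exact ⟨m + n, by simp_all⟩
  | neg y _ hy =>
    obtain ⟨m, hm⟩ := hy
    exact ⟨-m, by simp_all⟩

theorem latticeForm_latticeRoot {ω : H.root}
    (h : ∀ α : H.root, killingForm ℂ L (hc α) (hc α) = killingForm ℂ L (hc ω) (hc ω))
    (α β : H.root) : latticeForm ω (latticeRoot α) (latticeRoot β) =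
      (rootSystem H).pairingIn ℤ α β := by
  apply Int.cast_injective (α := ℂ)
  rw [latticeForm_cast h, corootMap_comm, latticeRoot, latticeRoot, corootMap_root (h β)]
  exact ((rootSystem H).algebraMap_pairingIn ℤ α β).symm

theorem latticeForm_add_left {ω : H.root}
    (h : ∀ α : H.root, killingForm ℂ L (hc α) (hc α) = killingForm ℂ L (hc ω) (hc ω))
    (x y z : rootLattice H) : latticeForm ω (x + y) z = latticeForm ω x z + latticeForm ω y z := by
  apply Int.cast_injective (α := ℂ)
  simp [latticeForm_cast h]

theorem pairingIn_cases {ω : H.root}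
    (h : ∀ α : H.root, killingForm ℂ L (hc α) (hc α) = killingForm ℂ L (hc ω) (hc ω))
    (α β : H.root) : ((rootSystem H).pairingIn ℤ α β, (rootSystem H).pairingIn ℤ β α) ∈
      ({(0, 0), (1, 1), (-1, -1), (2, 2), (-2, -2)} : Set (ℤ × ℤ)) := by
  refine (rootSystem H).flip.pairingIn_pairingIn_mem_set_of_length_eq (i := β) (j := α)
    (B := (rootSystem H).flip.toInvariantForm) ?_
  change (rootSystem H).CorootForm (coroot β.1) (coroot β.1) =
    (rootSystem H).CorootForm (coroot α.1) (coroot α.1)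
  simpa using! (h β).trans (h α).symm

end SymSquare

/-! ### From a Chevalley basis to the abstract data. -/

namespace SymSquare

open LieAlgebra LieAlgebra.IsKilling LieModule

variable {L : Type*} [LieRing L] [LieAlgebra ℂ L] [FiniteDimensional ℂ L]
  {H : LieSubalgebra ℂ L} [H.IsCartanSubalgebra]

section Killing

variable [IsKilling ℂ L]

theorem exists_root_eq_add {α β : H.root} (hαβ : (rootSystem H).pairingIn ℤ α β = -1) :
    ∃ γ, (rootSystem H).root γ = (rootSystem H).root α + (rootSystem H).root β := by
  refine (rootSystem H).root_add_root_mem_of_pairingIn_neg (by omega) fun h1 => ?_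
  have h2 : (rootSystem H).pairing α β = -(rootSystem H).pairing β β := by
    rw [← RootPairing.root_coroot_eq_pairing, h1, map_neg, LinearMap.neg_apply,
      RootPairing.root_coroot_eq_pairing]
  rw [← (rootSystem H).algebraMap_pairingIn ℤ, hαβ, RootPairing.pairing_same] at h2
  norm_num at h2

theorem latticeRoot_negRoot (α : H.root) : latticeRoot (negRoot α) = -latticeRoot α :=
  Subtype.ext (root_negRoot α)

theorem latticeRoot_eq_add {α β γ : H.root} :
    latticeRoot γ = latticeRoot α + latticeRoot β ↔
      (rootSystem H).root γ = (rootSystem H).root α + (rootSystem H).root β :=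
  Subtype.ext_iff

namespace ChevalleyBasis

variable (B : ChevalleyBasis H)

theorem e_ne_zero (α : H.root) : B.e α ≠ 0 := by
  intro h
  have h1 := B.lie_e_neg α
  rw [h, zero_lie] at h1
  exact hc_ne_zero α h1.symm

theorem lie_coe_e (x : H) (α : H.root) : ⁅(x : L), B.e α⁆ = (rootSystem H).root α x • B.e α :=
  lie_eq_smul_of_mem_rootSpace (B.e_mem α) x

/-- The sum `α + β` is not a weight. It is nonzero because it pairs positively with `β`. If it were
a root `γ`, its pairing with `α` would be at least `2`, forcing `γ = α` and `β = 0`. -/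
theorem lie_e_e_of_nonneg {ω : H.root}
    (h : ∀ α : H.root, killingForm ℂ L (hc α) (hc α) = killingForm ℂ L (hc ω) (hc ω))
    {α β : H.root} (hαβ : 0 ≤ (rootSystem H).pairingIn ℤ α β) : ⁅B.e α, B.e β⁆ = 0 := by
  have h1 := lie_mem_genWeightSpace_of_mem_genWeightSpace (B.e_mem α) (B.e_mem β)
  have hsymm : (rootSystem H).pairingIn ℤ β α = (rootSystem H).pairingIn ℤ α β := by
    have := pairingIn_cases h α β
    simp only [Set.mem_insert_iff, Set.mem_singleton_iff, Prod.mk.injEq] at this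
    omega
  suffices genWeightSpace L ((α.1 : H → ℂ) + (β.1 : H → ℂ)) = ⊥ by
    rw [this] at h1
    exact h1
  by_contra hne
  let χ : Weight ℂ H L := ⟨_, hne⟩
  have hχ : (χ : H → ℂ) = (α.1 : H → ℂ) + (β.1 : H → ℂ) := rfl
  have hself (γ : H.root) : (rootSystem H).pairingIn ℤ γ γ = 2 := by simp
  by_cases h0 : χ.IsZero
  · have h2 := congrFun (hχ.symm.trans h0) (coroot β.1)
    have h3 : (rootSystem H).pairing α β + (rootSystem H).pairing β β = 0 := h2
    rw [← (rootSystem H).algebraMap_pairingIn ℤ, ← (rootSystem H).algebraMap_pairingIn ℤ,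
      ← map_add, hself] at h3
    have := (algebraMap ℤ ℂ).injective_int (h3.trans (map_zero _).symm)
    omega
  · let γ : H.root := ⟨χ, by simpa using h0⟩
    have key (δ : H.root) : (rootSystem H).pairingIn ℤ γ δ =
        (rootSystem H).pairingIn ℤ α δ + (rootSystem H).pairingIn ℤ β δ := by
      apply (algebraMap ℤ ℂ).injective_int
      rw [map_add]
      simp only [(rootSystem H).algebraMap_pairingIn ℤ]
      exact congrFun hχ (coroot δ.1)
    have k1 := key α
    have k2 := key β
    have k3 := pairingIn_cases h γ α
    have k4 := pairingIn_cases h γ β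
    have k5 := hself α
    have k6 := hself β
    have k7 := (rootSystem H).pairingIn_two_two_iff ℤ γ α
    simp only [Set.mem_insert_iff, Set.mem_singleton_iff, Prod.mk.injEq] at k3 k4
    have h4 : γ = α := k7.mp ⟨by omega, by omega⟩
    have h5 : (rootSystem H).root γ = (rootSystem H).root α + (rootSystem H).root β := by
      ext x
      exact congrFun hχ x
    have h6 := add_eq_left.mp (h5.symm.trans (congrArg _ h4))
    exact (rootSystem H).ne_zero β h6

/-- The data of a Chevalley basis of a Lie algebra all of whose roots have the same length. -/
noncomputable def toData (ω : H.root)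
    (h : ∀ α : H.root, killingForm ℂ L (hc α) (hc α) = killingForm ℂ L (hc ω) (hc ω)) :
    SimplyLacedData (rootLattice H) L where
  Φ := Set.range latticeRoot
  p := latticeForm ω
  h x := (corootMap ω x.1 : H)
  -- The default value `0` off the roots is immaterial: every axiom on `e` and `N` concerns roots
  -- only.
  e := Function.extend latticeRoot B.e 0
  N x y := Function.extend (Prod.map latticeRoot latticeRoot) (fun a => B.c a.1 a.2) 0 (x, y)
  p_add_left := latticeForm_add_left h
  p_comm x y := by rw [latticeForm, latticeForm, corootMap_comm]
  p_self := by
    rintro _ ⟨α, rfl⟩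
    rw [latticeForm_latticeRoot h]
    simp
  neg_le_p := by
    rintro _ _ ⟨α, rfl⟩ ⟨β, rfl⟩
    rw [latticeForm_latticeRoot h]
    have := pairingIn_cases h α β
    simp only [Set.mem_insert_iff, Set.mem_singleton_iff, Prod.mk.injEq] at this
    omega
  eq_of_p_eq_two := by
    rintro _ _ ⟨α, rfl⟩ ⟨β, rfl⟩ hαβ
    rw [latticeForm_latticeRoot h] at hαβ
    have := pairingIn_cases h α β
    simp only [Set.mem_insert_iff, Set.mem_singleton_iff, Prod.mk.injEq] at this
    rw [((rootSystem H).pairingIn_two_two_iff ℤ α β).mp ⟨by omega, by omega⟩]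
  neg_mem := by
    rintro _ ⟨α, rfl⟩
    exact ⟨negRoot α, latticeRoot_negRoot α⟩
  add_mem := by
    rintro _ _ ⟨α, rfl⟩ ⟨β, rfl⟩ hαβ
    rw [latticeForm_latticeRoot h] at hαβ
    obtain ⟨γ, hγ⟩ := exists_root_eq_add hαβ
    exact ⟨γ, latticeRoot_eq_add.mpr hγ⟩
  h_add x y := by simp
  e_ne_zero := by
    rintro _ ⟨α, rfl⟩
    rw [latticeRoot_injective.extend_apply]
    exact B.e_ne_zero α
  lie_h_e := by
    rintro x _ ⟨α, rfl⟩
    rw [latticeRoot_injective.extend_apply, B.lie_coe_e, latticeForm_cast h]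
    rfl
  lie_e_neg := by
    rintro _ ⟨α, rfl⟩
    rw [← latticeRoot_negRoot, latticeRoot_injective.extend_apply,
      latticeRoot_injective.extend_apply, B.lie_e_neg]
    exact congrArg Subtype.val (corootMap_root (h α)).symm
  lie_e_e' := by
    rintro _ _ ⟨α, rfl⟩ ⟨β, rfl⟩ hαβ
    rw [latticeForm_latticeRoot h] at hαβ
    obtain ⟨γ, hγ⟩ := exists_root_eq_add hαβ
    rw [← latticeRoot_eq_add.mpr hγ, latticeRoot_injective.extend_apply,
      latticeRoot_injective.extend_apply, latticeRoot_injective.extend_apply, B.lie_e_e α β γ hγ]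
    exact congrArg (· • B.e γ) ((latticeRoot_injective.prodMap latticeRoot_injective).extend_apply
      (fun a => B.c a.1 a.2) 0 (α, β)).symm
  lie_e_e_of_nonneg := by
    rintro _ _ ⟨α, rfl⟩ ⟨β, rfl⟩ hαβ
    rw [latticeForm_latticeRoot h] at hαβ
    rw [latticeRoot_injective.extend_apply, latticeRoot_injective.extend_apply,
      B.lie_e_e_of_nonneg h hαβ]
  N_neg := by
    rintro _ _ ⟨α, rfl⟩ ⟨β, rfl⟩ hαβ
    rw [latticeForm_latticeRoot h] at hαβ
    obtain ⟨γ, hγ⟩ := exists_root_eq_add hαβ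
    have key (α β : H.root) := (latticeRoot_injective.prodMap latticeRoot_injective).extend_apply
      (fun a => B.c a.1 a.2) 0 (α, β)
    rw [← latticeRoot_negRoot, ← latticeRoot_negRoot]
    exact (key α β).trans ((B.c_neg α β γ hγ).trans (congrArg _ (key _ _).symm))

variable {ω : H.root}
  (h : ∀ α : H.root, killingForm ℂ L (hc α) (hc α) = killingForm ℂ L (hc ω) (hc ω))

@[simp] theorem toData_e (α : H.root) : (B.toData ω h).e (latticeRoot α) = B.e α :=
  latticeRoot_injective.extend_apply B.e 0 α

@[simp] theorem toData_h (α : H.root) : (B.toData ω h).h (latticeRoot α) = hc α :=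
  congrArg Subtype.val (corootMap_root (h α))

@[simp] theorem toData_N (α β : H.root) :
    (B.toData ω h).N (latticeRoot α) (latticeRoot β) = B.c α β :=
  (latticeRoot_injective.prodMap latticeRoot_injective).extend_apply
    (fun a => B.c a.1 a.2) 0 (α, β)

theorem mem_toData_Φ (α : H.root) : latticeRoot α ∈ (B.toData ω h).Φ := ⟨α, rfl⟩

theorem toData_p (α β : H.root) : (B.toData ω h).p (latticeRoot α) (latticeRoot β) =
    (rootSystem H).pairingIn ℤ α β :=
  latticeForm_latticeRoot h α β

theorem kappa_eq_toData_p (α β : H.root) :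
    kappa ω α β = ((B.toData ω h).p (latticeRoot α) (latticeRoot β) : ℂ) := by
  rw [kappa_eq h, toData_p]
  exact ((rootSystem H).algebraMap_pairingIn ℤ α β).symm

end ChevalleyBasis

end Killing

section Simple

variable [LieAlgebra.IsSimple ℂ L]

/-- By irreducibility, a nonempty set of roots orthogonal to all roots outside its span must span
everything. A root missing from `S` would be orthogonal to this span, hence to itself. -/
theorem ChevalleyBasis.toData_isConnected (B : ChevalleyBasis H) {ω : H.root}
    (h : ∀ α : H.root, killingForm ℂ L (hc α) (hc α) = killingForm ℂ L (hc ω) (hc ω)) :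
    (B.toData ω h).IsConnected := by
  intro S hS hne hconn
  let s : Set H.root := latticeRoot ⁻¹' S
  have hs : s.Nonempty := by
    obtain ⟨x, hx⟩ := hne
    obtain ⟨α, rfl⟩ := hS hx
    exact ⟨α, hx⟩
  have hmem (α β : H.root) (hα : α ∈ s) (hαβ : (rootSystem H).pairingIn ℤ α β ≠ 0) : β ∈ s :=
    hconn _ hα _ (B.mem_toData_Φ h β) (by rwa [toData_p])
  have hspan := (rootSystem H).span_root_image_eq_top_of_forall_orthogonal s hs fun β hβ α hα => by
    suffices h0 : (rootSystem H).pairing α β = 0 from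
      ⟨(rootSystem H).pairing_eq_zero_iff.mp h0, h0⟩
    by_contra hne
    refine hβ (Submodule.subset_span ⟨β, hmem α β hα fun h0 => hne ?_, rfl⟩)
    rw [← (rootSystem H).algebraMap_pairingIn ℤ, h0, map_zero]
  refine hS.antisymm ?_
  rintro _ ⟨β, rfl⟩
  by_contra hβ
  have hker : Submodule.span ℂ ((rootSystem H).root '' s) ≤
      LinearMap.ker ((rootSystem H).coroot' β) := by
    rw [Submodule.span_le]
    rintro _ ⟨α, hα, rfl⟩
    have h0 : (rootSystem H).pairingIn ℤ α β = 0 := by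
      by_contra hne
      exact hβ (hmem α β hα hne)
    have h1 := (rootSystem H).algebraMap_pairingIn ℤ α β
    rw [h0, map_zero] at h1
    exact h1.symm
  rw [hspan] at hker
  have h2 : (rootSystem H).pairing β β = 0 := hker (Submodule.mem_top (x := (rootSystem H).root β))
  rw [RootPairing.pairing_same] at h2
  norm_num at h2

end Simple

end SymSquare

/-! ### Matching the sets `Γ` with the Cartan relations. -/

/-- This rewrites the coefficient in `Γ₃`. Cyclic symmetry turns the numerator into `N w x` and the
denominator into `N w y`; as these are signs, the ratio equals its inverse. -/
theorem SimplyLacedData.N_square {M L : Type*} [AddCommGroup M] [LieRing L] [LieAlgebra ℂ L]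
    (D : SimplyLacedData M L) {w x y u v : M} (hw : w ∈ D.Φ) (hx : x ∈ D.Φ) (hy : y ∈ D.Φ)
    (hwx : D.p w x = -1) (hwy : D.p w y = -1) (hu : u = w + x) (hv : v = w + y) :
    D.N u (-x) / D.N y (-v) = D.N w y / D.N w x := by
  have hxs := D.p_self x hx
  have hys := D.p_self y hy
  have hu' : u ∈ D.Φ := hu ▸ D.add_mem w x hw hx hwx
  have hv' : v ∈ D.Φ := hv ▸ D.add_mem w y hw hy hwy
  rw [D.N_cyc (z := -w) hu' (D.neg_mem x hx) (by grind) (by rw [hu]; abel),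
    D.N_comm (D.neg_mem x hx) (D.neg_mem w hw) (by grind), ← D.N_neg w x hw hx hwx,
    D.N_cyc (z := w) hy (D.neg_mem v hv') (by grind) (by rw [hv]; abel),
    D.N_cyc (z := y) (D.neg_mem v hv') hw (by grind) (by rw [hv]; abel)]
  have h1 := D.N_ne_zero hw hx hwx
  have h2 := D.N_ne_zero hw hy hwy
  field_simp
  linear_combination D.N_mul_self hw hx hwx - D.N_mul_self hw hy hwy

namespace SymSquare

open LieAlgebra LieAlgebra.IsKilling LieModule

variable {L : Type*} [LieRing L] [LieAlgebra ℂ L]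

section Product

variable {Q : Type*} [AddCommGroup Q] [Module ℂ Q]

variable (L) in
/-- The product of the symmetric square as a bilinear map. -/
noncomputable def prodLin : L →ₗ[ℂ] L →ₗ[ℂ] S2 ℂ L :=
  (TensorProduct.mk ℂ L L).compr₂ (LieSubmodule.Quotient.mk' (antiRel ℂ L)).toLinearMap

theorem prodLin_apply (x y : L) : prodLin L x y = prod ℂ x y := rfl

theorem map_lie_prod (f : S2 ℂ L →ₗ[ℂ] Q) (l x y : L) :
    f ⁅l, prod ℂ x y⁆ = SimplyLacedData.deriv ((prodLin L).compr₂ f) l x y := by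
  rw [lie_prod, map_add]
  rfl

end Product

variable [FiniteDimensional ℂ L] {H : LieSubalgebra ℂ L} [H.IsCartanSubalgebra] [IsKilling ℂ L]
  (B : ChevalleyBasis H) (ω : H.root)

/-- The union of the sets `Γ₀, …, Γ₅`. -/
def Gamma : Set (S2 ℂ L) :=
  Gamma0 B ∪ Gamma1 B ∪ Gamma2 B ω ∪ Gamma3 B ω ∪ Gamma4 B ω ∪ Gamma5 B

variable {B ω}

theorem forall_mem_Gamma {P : S2 ℂ L → Prop} :
    (∀ v ∈ Gamma B ω, P v) ↔ (∀ v ∈ Gamma0 B, P v) ∧ (∀ v ∈ Gamma1 B, P v) ∧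
      (∀ v ∈ Gamma2 B ω, P v) ∧ (∀ v ∈ Gamma3 B ω, P v) ∧ (∀ v ∈ Gamma4 B ω, P v) ∧
      (∀ v ∈ Gamma5 B, P v) := by
  simp only [Gamma, Set.mem_union, or_imp, forall_and, and_assoc]

variable {Q : Type*} [AddCommGroup Q] [Module ℂ Q] (f : S2 ℂ L →ₗ[ℂ] Q)
  (h : ∀ α : H.root, killingForm ℂ L (hc α) (hc α) = killingForm ℂ L (hc ω) (hc ω))

/-- The configuration of roots underlying the elements of `Γ₃`. -/
theorem exists_square_of_kappa_eq_zero (B : ChevalleyBasis H) {α β γ δ : H.root}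
    (hαβ : kappa ω α β = 0)
    (hsum : (rootSystem H).root γ + (rootSystem H).root δ =
      (rootSystem H).root α + (rootSystem H).root β)
    (hne : ({γ, δ} : Set H.root) ≠ {α, β}) :
    ∃ w ∈ (B.toData ω h).Φ, (B.toData ω h).p (latticeRoot γ) (latticeRoot β) = 1 ∧
      (B.toData ω h).p w (latticeRoot γ) = -1 ∧ (B.toData ω h).p w (latticeRoot β) = -1 ∧
      latticeRoot α = w + latticeRoot γ ∧ latticeRoot δ = w + latticeRoot β := by
  set D := B.toData ω h
  rw [B.kappa_eq_toData_p h] at hαβ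
  replace hαβ : D.p (latticeRoot α) (latticeRoot β) = 0 := by exact_mod_cast hαβ
  have hsum' : latticeRoot γ + latticeRoot δ = latticeRoot α + latticeRoot β := Subtype.ext hsum
  have hα := B.mem_toData_Φ h α
  have hβ := B.mem_toData_Φ h β
  have hγ := B.mem_toData_Φ h γ
  have hδ := B.mem_toData_Φ h δ
  have h1 := D.p_self _ hα
  have h2 := D.p_self _ hβ
  have h3 := D.p_self _ hγ
  have h4 := D.p_self _ hδ
  have h5 := D.p_comm (latticeRoot α) (latticeRoot β)
  have h6 : D.p (latticeRoot γ) (latticeRoot α) + D.p (latticeRoot δ) (latticeRoot α) = 2 := by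
    rw [← D.p_add_left, hsum', D.p_add_left]
    omega
  have h7 : D.p (latticeRoot γ) (latticeRoot β) + D.p (latticeRoot δ) (latticeRoot β) = 2 := by
    rw [← D.p_add_left, hsum', D.p_add_left]
    omega
  have h8 : D.p (latticeRoot γ) (latticeRoot γ) + D.p (latticeRoot γ) (latticeRoot δ) =
      D.p (latticeRoot γ) (latticeRoot α) + D.p (latticeRoot γ) (latticeRoot β) := by
    rw [← D.p_add_right, hsum', D.p_add_right]
  have h9 : D.p (latticeRoot δ) (latticeRoot γ) + D.p (latticeRoot δ) (latticeRoot δ) =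
      D.p (latticeRoot δ) (latticeRoot α) + D.p (latticeRoot δ) (latticeRoot β) := by
    rw [← D.p_add_right, hsum', D.p_add_right]
  have h10 := D.p_comm (latticeRoot γ) (latticeRoot δ)
  have h11 := D.p_le _ _ hγ hα
  have h12 := D.p_le _ _ hγ hβ
  have h13 : D.p (latticeRoot γ) (latticeRoot α) ≠ 2 := fun h0 => by
    have e1 := D.eq_of_p_eq_two _ _ hγ hα h0
    rw [e1, add_right_inj] at hsum'
    rw [latticeRoot_injective e1, latticeRoot_injective hsum'] at hne
    exact hne rfl
  have h14 : D.p (latticeRoot γ) (latticeRoot β) ≠ 2 := fun h0 => by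
    have e1 := D.eq_of_p_eq_two _ _ hγ hβ h0
    rw [e1, add_comm, add_left_inj] at hsum'
    rw [latticeRoot_injective e1, latticeRoot_injective hsum'] at hne
    exact hne (Set.pair_comm _ _)
  -- Adding the four equations `h6`–`h9` shows that `γ` and `δ` are orthogonal. So the pairings of
  -- `γ` with `α` and `β` sum to `2`; neither is `2`, hence both are `1`, and `w = α - γ` is a root.
  have h15 : D.p (latticeRoot γ) (latticeRoot α) = 1 := by omega
  have h16 := D.p_comm (latticeRoot γ) (latticeRoot α)
  have h17 : latticeRoot α - latticeRoot γ ∈ D.Φ := by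
    rw [sub_eq_add_neg]
    exact D.add_mem _ _ hα (D.neg_mem _ hγ) (by rw [D.p_neg_right]; omega)
  refine ⟨_, h17, by omega, by rw [D.p_sub_left]; omega, by rw [D.p_sub_left]; omega, by abel, ?_⟩
  rw [sub_add_eq_add_sub, ← hsum']
  abel

theorem cartanRelations_of_Gamma (hf : ∀ v ∈ Gamma B ω, f v = 0) :
    (B.toData ω h).CartanRelations ((prodLin L).compr₂ f) := by
  obtain ⟨f0, f1, f2, f3, f4, f5⟩ := forall_mem_Gamma.mp hf
  have hf1 (α : H.root) : f (prod ℂ (B.e α) (hc α)) = 0 := f1 _ ⟨α, rfl⟩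
  constructor
  · intro x y
    simp only [LinearMap.compr₂_apply, prodLin_apply, prod_comm x y]
  · rintro _ ⟨α, rfl⟩
    rw [← latticeRoot_negRoot]
    simpa [prodLin_apply, sub_eq_zero] using f0 _ ⟨α, rfl⟩
  · rintro _ ⟨α, rfl⟩
    simpa [prodLin_apply] using hf1 α
  · rintro _ _ _ ⟨α, rfl⟩ ⟨β, rfl⟩ hαβ hγ
    obtain ⟨γ, rfl⟩ := hγ ▸ (B.toData ω h).add_mem _ _ ⟨α, rfl⟩ ⟨β, rfl⟩ hαβ
    have h1 := f2 _ ⟨α, β, γ, by rw [B.kappa_eq_toData_p h, hαβ]; simp, latticeRoot_eq_add.mp hγ,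
      rfl⟩
    have h2 := hf1 γ
    have h3 : hc γ = hc α + hc β := by
      have := (B.toData ω h).h_add (latticeRoot α) (latticeRoot β)
      rw [← hγ] at this
      simpa using this
    rw [h3] at h2
    simp only [← prodLin_apply, map_add, map_sub, map_smul, LinearMap.compr₂_apply,
      ChevalleyBasis.toData_e, ChevalleyBasis.toData_h, ChevalleyBasis.toData_N] at h1 h2 ⊢
    -- The relation `q(e_γ, h_α + h_β) = 0` from `Γ₁` replaces `h_β - h_α` by `-2 h_α`.
    linear_combination (norm := module) (1 / 2 : ℂ) • h1 - (B.c α β / 2) • h2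
  · rintro w _ _ _ _ hw ⟨γ, rfl⟩ ⟨β, rfl⟩ hγβ hwγ hwβ hα hδ
    have hγ := B.mem_toData_Φ h γ
    have hβ := B.mem_toData_Φ h β
    obtain ⟨α, rfl⟩ := hα ▸ (B.toData ω h).add_mem _ _ hw hγ hwγ
    obtain ⟨δ, rfl⟩ := hδ ▸ (B.toData ω h).add_mem _ _ hw hβ hwβ
    have k1 := (B.toData ω h).p_self _ hβ
    have k2 := (B.toData ω h).p_self _ hγ
    have h1 := f3 _ ⟨α, β, γ, δ, ?_, ?_, ?_, rfl⟩
    · have h2 := (B.toData ω h).N_square hw hγ hβ hwγ hwβ hα hδ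
      have h3 := (B.toData ω h).N_ne_zero hw hγ hwγ
      rw [← latticeRoot_negRoot, ← latticeRoot_negRoot] at h2
      simp only [ChevalleyBasis.toData_N] at h2
      rw [h2] at h1
      simp only [← prodLin_apply, map_add, map_smul, LinearMap.compr₂_apply,
        ChevalleyBasis.toData_e] at h1 ⊢
      have h4 := congrArg ((B.toData ω h).N w (latticeRoot γ) • ·) h1
      simp only [smul_add, smul_smul, mul_div_cancel₀ _ h3, smul_zero] at h4
      exact h4
    · rw [B.kappa_eq_toData_p h, hα, (B.toData ω h).p_add_left, hwβ, hγβ]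
      simp
    · exact congrArg Subtype.val
        (show latticeRoot γ + latticeRoot δ = latticeRoot α + latticeRoot β by
        rw [hα, hδ]; abel)
    · intro h0
      have h2 : γ ∈ ({α, β} : Set H.root) := h0 ▸ Set.mem_insert γ {δ}
      rcases h2 with rfl | h2
      · rw [eq_comm, add_eq_right] at hα
        rw [hα, (B.toData ω h).p_zero_left] at hwβ
        omega
      · rw [Set.mem_singleton_iff] at h2
        rw [h2] at hγβ
        omega
  · rintro _ _ ⟨α, rfl⟩ ⟨β, rfl⟩ hαβ
    simp only [LinearMap.compr₂_apply, ChevalleyBasis.toData_e, prodLin_apply]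
    obtain h1 | h1 : (B.toData ω h).p (latticeRoot α) (latticeRoot β) = 1 ∨
        (B.toData ω h).p (latticeRoot α) (latticeRoot β) = 2 := by
      have := (B.toData ω h).p_le _ _ (B.mem_toData_Φ h α) (B.mem_toData_Φ h β)
      omega
    · exact f4 _ ⟨α, β, by rw [B.kappa_eq_toData_p h, h1]; simp, rfl⟩
    · have h2 := (B.toData ω h).eq_of_p_eq_two _ _ ⟨α, rfl⟩ ⟨β, rfl⟩ h1
      rw [latticeRoot_injective h2]
      exact f5 _ ⟨β, rfl⟩

section

variable {f h}

theorem map_Gamma_eq_zero (hq : (B.toData ω h).CartanRelations ((prodLin L).compr₂ f)) :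
    ∀ v ∈ Gamma B ω, f v = 0 := by
  set D := B.toData ω h with hD
  refine forall_mem_Gamma.mpr ⟨?_, ?_, ?_, ?_, ?_, ?_⟩
  · rintro _ ⟨α, rfl⟩
    have := hq.e_neg _ (B.mem_toData_Φ h α)
    rw [← latticeRoot_negRoot] at this
    simpa [hD, prodLin_apply, sub_eq_zero] using this
  · rintro _ ⟨α, rfl⟩
    simpa [hD, prodLin_apply] using hq.e_h _ (B.mem_toData_Φ h α)
  · rintro _ ⟨α, β, γ, hαβ, hγ, rfl⟩
    rw [B.kappa_eq_toData_p h] at hαβ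
    have hαβ' : D.p (latticeRoot α) (latticeRoot β) = -1 := by exact_mod_cast hαβ
    have h1 := hq.e_e _ _ _ (B.mem_toData_Φ h α) (B.mem_toData_Φ h β) hαβ'
      (latticeRoot_eq_add.mpr hγ)
    have h2 := hq.e_h_of_add (B.mem_toData_Φ h γ) (latticeRoot_eq_add.mpr hγ)
    simp only [hD, LinearMap.compr₂_apply, ChevalleyBasis.toData_e, ChevalleyBasis.toData_h,
      ChevalleyBasis.toData_N] at h1 h2
    simp only [← prodLin_apply, map_add, map_sub, map_smul]
    linear_combination (norm := module) (2 : ℂ) • h1 + B.c α β • h2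
  · rintro _ ⟨α, β, γ, δ, hαβ, hsum, hne, rfl⟩
    obtain ⟨w, hw, hγβ, hwγ, hwβ, hα, hδ⟩ := exists_square_of_kappa_eq_zero h B hαβ hsum hne
    have hγ := B.mem_toData_Φ h γ
    have hβ := B.mem_toData_Φ h β
    have h1 := hq.square w _ _ _ _ hw hγ hβ hγβ hwγ hwβ hα hδ
    have h2 := D.N_square hw hγ hβ hwγ hwβ hα hδ
    have h3 := D.N_ne_zero hw hγ hwγ
    rw [← latticeRoot_negRoot, ← latticeRoot_negRoot] at h2
    simp only [hD, ChevalleyBasis.toData_N] at h2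
    rw [h2]
    simp only [← prodLin_apply, map_add, map_smul]
    simp only [hD, LinearMap.compr₂_apply, ChevalleyBasis.toData_e] at h1
    refine (smul_eq_zero.mp (?_ : D.N w (latticeRoot γ) • (_ : Q) = 0)).resolve_left h3
    rw [smul_add, smul_smul, mul_div_cancel₀ _ h3]
    exact h1
  · rintro _ ⟨α, β, hαβ, rfl⟩
    rw [B.kappa_eq_toData_p h] at hαβ
    have hαβ' : D.p (latticeRoot α) (latticeRoot β) = 1 := by exact_mod_cast hαβ
    simpa [hD, prodLin_apply] using
      hq.e_e_of_pos _ _ (B.mem_toData_Φ h α) (B.mem_toData_Φ h β) hαβ'.ge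
  · rintro _ ⟨α, rfl⟩
    have h1 := D.p_self _ (B.mem_toData_Φ h α)
    simpa [hD, prodLin_apply] using
      hq.e_e_of_pos _ _ (B.mem_toData_Φ h α) (B.mem_toData_Φ h α) (by omega)

/-- With `f` the quotient map by the span of `Γ`, this says that root vectors preserve that span. -/
theorem map_lie_Gamma_eq_zero (hq : (B.toData ω h).CartanRelations ((prodLin L).compr₂ f))
    (ε : H.root) : ∀ v ∈ Gamma B ω, f ⁅B.e ε, v⁆ = 0 := by
  set D := B.toData ω h with hD
  have hε := B.mem_toData_Φ h ε
  refine forall_mem_Gamma.mpr ⟨?_, ?_, ?_, ?_, ?_, ?_⟩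
  · rintro _ ⟨α, rfl⟩
    have := hq.deriv_e_neg hε (B.mem_toData_Φ h α)
    rw [← latticeRoot_negRoot] at this
    simpa [hD, map_lie_prod, sub_eq_zero] using this
  · rintro _ ⟨α, rfl⟩
    simpa [hD, map_lie_prod] using hq.deriv_e_h_self hε (B.mem_toData_Φ h α)
  · rintro _ ⟨α, β, γ, hαβ, hγ, rfl⟩
    rw [B.kappa_eq_toData_p h] at hαβ
    have hαβ' : D.p (latticeRoot α) (latticeRoot β) = -1 := by exact_mod_cast hαβ
    have hγ' := latticeRoot_eq_add.mpr hγ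
    have h1 := hq.deriv_e_e hε (B.mem_toData_Φ h α) (B.mem_toData_Φ h β) hαβ' hγ'
    have h2 := hq.deriv_e_h_self hε (B.mem_toData_Φ h γ)
    have h3 : hc γ = hc α + hc β := by
      have := D.h_add (latticeRoot α) (latticeRoot β)
      rw [← hγ'] at this
      simpa [hD] using this
    simp only [hD, ChevalleyBasis.toData_e, ChevalleyBasis.toData_h, ChevalleyBasis.toData_N,
      h3, ← map_lie_prod] at h1 h2
    simp only [← prodLin_apply, map_add, map_sub, map_smul, lie_add, lie_sub, lie_smul] at h1 h2 ⊢
    linear_combination (norm := module) (2 : ℂ) • h1 + B.c α β • h2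
  · rintro _ ⟨α, β, γ, δ, hαβ, hsum, hne, rfl⟩
    obtain ⟨w, hw, hγβ, hwγ, hwβ, hα, hδ⟩ := exists_square_of_kappa_eq_zero h B hαβ hsum hne
    have hγ := B.mem_toData_Φ h γ
    have hβ := B.mem_toData_Φ h β
    have h1 := hq.deriv_square hε hw hγ hβ hγβ hwγ hwβ hα hδ
    have h2 := D.N_square hw hγ hβ hwγ hwβ hα hδ
    have h3 := D.N_ne_zero hw hγ hwγ
    rw [← latticeRoot_negRoot, ← latticeRoot_negRoot] at h2
    simp only [hD, ChevalleyBasis.toData_N] at h2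
    rw [h2]
    simp only [hD, ChevalleyBasis.toData_e] at h1
    rw [lie_add, lie_smul, map_add, map_smul, map_lie_prod, map_lie_prod]
    refine (smul_eq_zero.mp (?_ : D.N w (latticeRoot γ) • (_ : Q) = 0)).resolve_left h3
    rw [smul_add, smul_smul, mul_div_cancel₀ _ h3]
    exact h1
  · rintro _ ⟨α, β, hαβ, rfl⟩
    rw [B.kappa_eq_toData_p h] at hαβ
    have hαβ' : D.p (latticeRoot α) (latticeRoot β) = 1 := by exact_mod_cast hαβ
    simpa [hD, map_lie_prod] using
      hq.deriv_e_e_of_pos hε (B.mem_toData_Φ h α) (B.mem_toData_Φ h β) hαβ'.ge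
  · rintro _ ⟨α, rfl⟩
    have h1 := D.p_self _ (B.mem_toData_Φ h α)
    simpa [hD, map_lie_prod] using
      hq.deriv_e_e_of_pos hε (B.mem_toData_Φ h α) (B.mem_toData_Φ h α) (by omega)

end

end SymSquare

/-! ### Generation by root vectors and the two inclusions. -/

namespace SymSquare

open LieAlgebra LieAlgebra.IsKilling LieModule

variable {L : Type*} [LieRing L] [LieAlgebra ℂ L] [FiniteDimensional ℂ L]
  {H : LieSubalgebra ℂ L} [H.IsCartanSubalgebra]

/-- Root space decomposition: the coroots span the Cartan subalgebra, and each root space is a line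
spanned by its root vector. -/
theorem ChevalleyBasis.eq_top_of_forall_mem [IsKilling ℂ L] (B : ChevalleyBasis H)
    (U : Submodule ℂ L) (he : ∀ α, B.e α ∈ U) (hh : ∀ α : H.root, hc α ∈ U) : U = ⊤ := by
  have hH : H.toSubmodule ≤ U := by
    intro x hx
    have h1 : (⟨x, hx⟩ : H) ∈ Submodule.span ℂ (Set.range (rootSystem H).coroot) := by
      rw [RootPairing.IsRootSystem.span_coroot_eq_top]
      trivial
    have h2 : Submodule.span ℂ (Set.range (rootSystem H).coroot) ≤
        U.comap H.toSubmodule.subtype := by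
      rw [Submodule.span_le]
      rintro _ ⟨α, rfl⟩
      exact hh α
    exact h2 h1
  have htop := iSup_genWeightSpace_eq_top' ℂ H L
  rw [← LieSubmodule.toSubmodule_inj, LieSubmodule.iSup_toSubmodule,
    LieSubmodule.top_toSubmodule] at htop
  rw [eq_top_iff, ← htop, iSup_le_iff]
  intro χ
  by_cases h0 : χ.IsZero
  · rw [h0.eq]
    refine le_trans ?_ hH
    intro x hx
    rw [← zeroRootSubalgebra_eq_of_is_cartan ℂ L H]
    exact hx
  · let α : H.root := ⟨χ, by simpa using h0⟩
    have h1 := finrank_rootSpace_eq_one χ h0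
    intro x hx
    obtain ⟨c, hc⟩ := exists_smul_eq_of_finrank_eq_one h1
      (x := (⟨B.e α, B.e_mem α⟩ : rootSpace H χ)) (fun h => B.e_ne_zero α (congrArg Subtype.val h))
      ⟨x, hx⟩
    have h2 : c • B.e α = x := congrArg Subtype.val hc
    exact h2 ▸ U.smul_mem c (he α)

theorem span_Gamma [LieAlgebra.IsSimple ℂ L] (b : (rootSystem H).Base)
    (hb : b.cartanMatrix.IsSimplyLaced) (B : ChevalleyBasis H) (ω : H.root) :
    Submodule.span ℂ (Gamma B ω) = (V B ω).toSubmodule := by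
  have h (α : H.root) := killingForm_hc_self_eq b hb α ω
  apply le_antisymm
  · rw [Submodule.span_le]
    let f := (LieSubmodule.Quotient.mk' (V B ω)).toLinearMap
    have hq : (B.toData ω h).CartanRelations ((prodLin L).compr₂ f) := by
      refine SimplyLacedData.cartanRelations_of_isConnected (w := latticeRoot ω) (fun x y => ?_)
        (fun l x y => ?_) (B.toData_isConnected h) (B.mem_toData_Φ h ω) ?_
      · simp only [LinearMap.compr₂_apply, prodLin_apply, prod_comm x y]
      · rw [← map_lie_prod]
        exact ((LieSubmodule.Quotient.mk' (V B ω)).map_lie _ _).symm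
      · rw [ChevalleyBasis.toData_e]
        exact (LieSubmodule.Quotient.mk_eq_zero (N := V B ω)).mpr
          (LieSubmodule.subset_lieSpan rfl)
    intro v hv
    exact (LieSubmodule.Quotient.mk_eq_zero (N := V B ω)).mp (map_Gamma_eq_zero hq v hv)
  · set W := Submodule.span ℂ (Gamma B ω) with hW
    have hq : (B.toData ω h).CartanRelations ((prodLin L).compr₂ W.mkQ) :=
      cartanRelations_of_Gamma _ h fun v hv =>
        (Submodule.Quotient.mk_eq_zero W).mpr (Submodule.subset_span hv)
    -- The stabiliser of `W`. It contains the root vectors, and hence every `h_α = ⁅e_α, e_{-α}⁆`,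
    -- so it is all of `L`.
    let U : Submodule ℂ L :=
      { carrier := {l | ∀ v ∈ W, ⁅l, v⁆ ∈ W}
        add_mem' := fun hx hy v hv => by
          rw [add_lie]
          exact W.add_mem (hx v hv) (hy v hv)
        zero_mem' := fun v _ => by
          rw [zero_lie]
          exact W.zero_mem
        smul_mem' := fun c x hx v hv => by
          rw [smul_lie]
          exact W.smul_mem c (hx v hv) }
    have he (α : H.root) : B.e α ∈ U := by
      intro v hv
      have h1 : W ≤ W.comap (toEnd ℂ L (S2 ℂ L) (B.e α)) := by
        rw [hW, Submodule.span_le]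
        exact fun v hv => (Submodule.Quotient.mk_eq_zero W).mp (map_lie_Gamma_eq_zero hq α v hv)
      exact h1 hv
    have hU : U = ⊤ := B.eq_top_of_forall_mem U he fun α v hv => by
      rw [← B.lie_e_neg α, lie_lie]
      exact W.sub_mem (he _ _ (he _ _ hv)) (he _ _ (he _ _ hv))
    let W' : LieSubmodule ℂ L (S2 ℂ L) :=
      { W with
        lie_mem := fun {l v} hv => (hU.ge (Submodule.mem_top (x := l)) : l ∈ U) v hv }
    suffices V B ω ≤ W' from this
    rw [V, LieSubmodule.lieSpan_le, Set.singleton_subset_iff]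
    exact Submodule.subset_span (Or.inr ⟨ω, rfl⟩)

end SymSquare

theorem mainTheorem6 {L : Type*} [LieRing L] [LieAlgebra ℂ L] [FiniteDimensional ℂ L]
    [LieAlgebra.IsSimple ℂ L] (H : LieSubalgebra ℂ L) [H.IsCartanSubalgebra]
    (b : (LieAlgebra.IsKilling.rootSystem H).Base)
    (hlaced : b.cartanMatrix.IsSimplyLaced) (hrank : 3 ≤ b.support.card)
    (B : SymSquare.ChevalleyBasis H) (ω : H.root) (hω : SymSquare.IsHighestRoot b ω) :
    Submodule.span ℂ
        (SymSquare.Gamma0 B ∪ SymSquare.Gamma1 B ∪ SymSquare.Gamma2 B ω ∪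
          SymSquare.Gamma3 B ω ∪ SymSquare.Gamma4 B ω ∪ SymSquare.Gamma5 B) =
      (SymSquare.V B ω).toSubmodule :=
  SymSquare.span_Gamma b hlaced B ω
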